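/- Let $p>3$ be a prime, let $H_k=\sum_{j=1}^{k}\frac1j$ (so $H_0=0$), let $q_p(2)=\frac{2^{p-1}-1}{p}$ be the Fermat quotient, and let $\Gamma_p:\mathbb{Z}_p\to\mathbb{Z}_p$ be Morita's $p$-adic Gamma function, i.e. the continuous extension to $\mathbb{Z}_p$ of the sequence $n\mapsto(-1)^n\prod_{0\le k<n,\ \gcd(k,p)=1}k$ (where $n>1$). For $a,b\in\mathbb{Q}_p$ write $a\equiv b\pmod{p^2}$ if $a-b\in p^2\mathbb{Z}_p$. Then $$\sum_{k=0}^{p-1}\frac{\binom{2k}{k}^3}{64^k}\bigl(2-3(4k+1)H_k\bigr)(-1)^k\equiv(-1)^{\frac{p-1}{2}}\bigl(2+6p\,q_p(2)\bigr)\pmod{p^2},$$ $$\sum_{k=0}^{p-1}\frac{\binom{2k}{k}^4}{256^k}\bigl(2-4(4k+1)H_k\bigr)\equiv 2+12p\,q_p(2)\pmod{p^2},$$ $$\sum_{k=0}^{p-1}\frac{\binom{2k}{k}^5}{1024^k}\bigl(2-5(4k+1)H_k\bigr)(-1)^k\equiv\begin{cases}-\bigl(2+10p\,q_p(2)\bigr)\,\Gamma_p\!\left(\tfrac14\right)^4&\text{if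 }p\equiv1\pmod 4,\\[2mm] 0&\text{if }p\equiv3\pmod 4,\end{cases}\pmod{p^2}.$$ -/

import Mathlib

open Filter Topology

noncomputable section

/-- The Fermat quotient `q_p(a) = (a ^ (p - 1) - 1) / p`, as a rational number. -/
def fermatQuotient (p a : ℕ) : ℚ := ((a : ℚ) ^ (p - 1) - 1) / p

/-- The sequence `n ↦ (-1) ^ n * ∏ k`, the product over `0 ≤ k < n` with `k` prime to `p`,
which Morita's `p`-adic Gamma function interpolates. -/
def moritaSeq (p : ℕ) [Fact p.Prime] (n : ℕ) : ℤ_[p] :=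
  (-1) ^ n * ∏ k ∈ (Finset.range n).filter (fun k => Nat.Coprime k p), (k : ℤ_[p])

/-- Morita's `p`-adic Gamma function `Γ_p : ℤ_p → ℤ_p` (for an odd prime `p`): the extension by
continuity of `moritaSeq p`, i.e. `Γ_p(x)` is the limit of `moritaSeq p n` as the natural number
`n` tends to `x` in the `p`-adic topology. -/
def padicGamma (p : ℕ) [Fact p.Prime] (x : ℤ_[p]) : ℤ_[p] :=
  limUnder (comap (fun n : ℕ => (n : ℤ_[p])) (𝓝 x)) (moritaSeq p)

/-- `a ≡ b (mod p ^ n)` for `p`-adic numbers: `a - b` lies in `p ^ n ℤ_p`. For rational numbers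
this says that `a - b` is `p ^ n` times a rational number whose denominator is prime to `p`. -/
def PadicModEq (p : ℕ) [Fact p.Prime] (n : ℕ) (a b : ℚ_[p]) : Prop :=
  ∃ z : ℤ_[p], a - b = (p : ℚ_[p]) ^ n * (z : ℚ_[p])

end

/-!
Harmonic numbers arise by differentiating in a parameter. Write `p = 2 n + 1` and give the
hypergeometric term the leading parameter `(1 + t p) / 2`: its first-order coefficient in `t p` is a
multiple of `H_k`, so the suitably weighted difference of the terms at `t = 1` and `t = -1` is `p`
times the given summand modulo `p ^ 3`. At `t = -1` the terms cancel in pairs under `k ↦ n - k`. At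
`t = 1` they form a terminating very-well-poised series, which Bailey's lemma evaluates as a product
for the exponents `3` and `4`, and as a product times a `₃F₂(1)` (Whipple's transformation) for the
exponent `5`. The duplication and reflection formulas reduce the products modulo `p ^ 2` to powers
of `4 ^ n = 2 ^ (p - 1) = 1 + p q_p(2)`.

Modulo `p ^ 2` the `₃F₂(1)` does not change when its parameters move by multiples of `p` with the
sums of the upper and of the lower ones preserved, and a suitable move makes it well-poised, so that
Dixon's theorem applies. If `p = 4 m + 3`, two numerator factors of Dixon's product are divisible by
`p`. If `p = 4 m + 1`, it is compared with `Γ_p(1/4)`, which is computed from the natural number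
`3 m p + 3 m + 1`, congruent to `1 / 4` modulo `p ^ 2`.
-/

section RisingFactorial

/-- The rising factorial `(x)_k = x (x + 1) ⋯ (x + k - 1)`, as a value of Mathlib's polynomial
`ascPochhammer`. -/
noncomputable def poch {R : Type*} [CommRing R] (x : R) (k : ℕ) : R := (ascPochhammer R k).eval x

variable {R : Type*} [CommRing R]

@[simp] lemma poch_zero (x : R) : poch x 0 = 1 := by simp [poch]

lemma poch_succ (x : R) (k : ℕ) : poch x (k + 1) = poch x k * (x + k) :=
  ascPochhammer_succ_eval k x

lemma poch_add (x : R) (j i : ℕ) : poch x (j + i) = poch x j * poch (x + j) i := by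
  simp [poch, ← ascPochhammer_mul]

lemma poch_succ_left (x : R) (k : ℕ) : poch x (k + 1) = x * poch (x + 1) k := by
  rw [add_comm, poch_add, poch_succ, poch_zero, one_mul, Nat.cast_zero, add_zero, Nat.cast_one]

lemma poch_eq_prod (x : R) (k : ℕ) : poch x k = ∏ i ∈ Finset.range k, (x + i) := by
  induction k with
  | zero => simp
  | succ k ih => rw [poch_succ, ih, Finset.prod_range_succ]

lemma poch_one (k : ℕ) : poch (1 : R) k = k.factorial := ascPochhammer_eval_one R k

lemma poch_neg_natCast_of_lt {n k : ℕ} (h : n < k) : poch (-(n : R)) k = 0 :=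
  ascPochhammer_eval_neg_coe_nat_of_lt h

/-- Reversing the order of the `j + k` factors splits the product into two rising factorials. -/
lemma poch_reflect_mul (x : R) (j k : ℕ) :
    poch (1 - (j + k : ℕ) - x) k * poch x j = (-1) ^ k * poch x (j + k) := by
  induction k with
  | zero => simp
  | succ k ih =>
    have shift : 1 - ((j + (k + 1) : ℕ) : R) - x + 1 = 1 - (j + k : ℕ) - x := by push_cast; ring
    rw [poch_succ_left, shift, mul_assoc, ih, ← add_assoc, poch_succ x]
    push_cast
    ring

lemma poch_reflect (x : R) (k : ℕ) : poch (1 - k - x) k = (-1) ^ k * poch x k := by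
  simpa using poch_reflect_mul x 0 k

lemma poch_neg_natCast_mul (j i : ℕ) :
    poch (-((j + i : ℕ) : R)) j * poch 1 i = (-1) ^ j * poch 1 (j + i) := by
  simpa [add_comm] using poch_reflect_mul (1 : R) i j

lemma poch_neg_natCast_self (n : ℕ) : poch (-(n : R)) n = (-1) ^ n * poch 1 n := by
  simpa using poch_neg_natCast_mul (R := R) n 0

lemma poch_neg_natCast_succ (n j : ℕ) :
    poch (-((n + 1 : ℕ) : R)) (j + 1) = -(n + 1) * poch (-(n : R)) j := by
  rw [poch_succ_left, Nat.cast_succ, neg_add_rev, neg_add_cancel_comm]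

lemma poch_ne_zero [IsDomain R] {x : R} (h : ∀ i : ℕ, x + i ≠ 0) (k : ℕ) : poch x k ≠ 0 :=
  poch_eq_prod x k ▸ Finset.prod_ne_zero_iff.2 fun i _ => h i

lemma poch_one_ne_zero [CharZero R] (k : ℕ) : poch (1 : R) k ≠ 0 :=
  poch_one (R := R) k ▸ Nat.cast_ne_zero.2 k.factorial_ne_zero

end RisingFactorial

section BalancedSums

variable {K : Type*} [Field K] [CharZero K]

lemma sum_poch_neg_natCast_succ (b : K) {f : K} (hf : ∀ i : ℕ, f + i ≠ 0) (n m : ℕ) :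
    ∑ j ∈ Finset.range (m + 1),
        poch (-((n + 1 : ℕ) : K)) j * poch b j / (poch 1 j * poch f j) =
      ∑ j ∈ Finset.range (m + 1), poch (-(n : K)) j * poch b j / (poch 1 j * poch f j) -
      b / f * ∑ j ∈ Finset.range m,
        poch (-(n : K)) j * poch (b + 1) j / (poch 1 j * poch (f + 1) j) := by
  rw [Finset.sum_range_succ', Finset.sum_range_succ' _ m, Finset.mul_sum, add_sub_right_comm,
    ← Finset.sum_sub_distrib]
  congr 1
  · refine Finset.sum_congr rfl fun j _ => ?_
    have hf0 : f ≠ 0 := by simpa using hf 0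
    have hf1 := poch_ne_zero (x := f + 1)
      (fun i => by simpa [add_assoc, add_comm (1 : K)] using hf (i + 1)) j
    have hj : (1 + j : K) ≠ 0 := by exact_mod_cast (by omega : 1 + j ≠ 0)
    have h1 := poch_one_ne_zero (R := K) j
    rw [poch_neg_natCast_succ, poch_succ (-(n : K)), poch_succ_left b, poch_succ_left f,
      poch_succ (1 : K)]
    field_simp
    ring
  · simp only [poch_zero]

theorem sum_chuVandermonde (b : K) {f : K} (hf : ∀ i : ℕ, f + i ≠ 0) (n : ℕ) :
    ∑ j ∈ Finset.range (n + 1), poch (-(n : K)) j * poch b j / (poch 1 j * poch f j) =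
      poch (f - b) n / poch f n := by
  induction n generalizing b f with
  | zero => simp
  | succ n ih =>
    have hf1 : ∀ i : ℕ, f + 1 + i ≠ 0 := fun i => by
      simpa [add_assoc, add_comm (1 : K)] using hf (i + 1)
    have hf0 : f ≠ 0 := by simpa using hf 0
    have hfn := hf n
    have hp := poch_ne_zero hf n
    have shift : f * poch (f + 1) n = poch f n * (f + n) := by rw [← poch_succ_left, poch_succ]
    have quotient : poch (f - b) n / poch (f + 1) n =
        f * poch (f - b) n / (poch f n * (f + n)) := by
      rw [← shift, mul_div_mul_left _ _ hf0]
    rw [sum_poch_neg_natCast_succ b hf, Finset.sum_range_succ,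
      poch_neg_natCast_of_lt n.lt_succ_self, zero_mul, zero_div, add_zero, ih b hf,
      ih (b + 1) hf1, add_sub_add_right_eq_sub, quotient, poch_succ, poch_succ]
    field_simp
    ring

lemma sum_saalschuetz_telescope (a f g : K) (hf : ∀ i : ℕ, f + i ≠ 0) (hg : ∀ i : ℕ, g + i ≠ 0)
    (n m : ℕ) :
    ∑ j ∈ Finset.range (m + 1), ((f + n) * (g + n) *
        (poch (-((n + 1 : ℕ) : K)) j * poch (a + (n + 1 : ℕ)) j * poch (f + g - 1 - a) j /
          (poch 1 j * poch f j * poch g j)) -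
        (1 + a - f + n) * (1 + a - g + n) *
        (poch (-(n : K)) j * poch (a + n) j * poch (f + g - 1 - a) j /
          (poch 1 j * poch f j * poch g j))) =
      (1 + a + 2 * n) * (poch (-(n : K)) m * poch (a + (n + 1 : ℕ)) m *
        poch (f + g - 1 - a) (m + 1)) / (poch 1 m * poch f m * poch g m) := by
  induction m with
  | zero => simp [poch_succ]; ring
  | succ m ih =>
    have h1 := poch_one_ne_zero (R := K) m
    have hfm := poch_ne_zero hf m
    have hgm := poch_ne_zero hg m
    have h1' : (1 + m : K) ≠ 0 := by exact_mod_cast (by omega : 1 + m ≠ 0)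
    have hf' := hf m
    have hg' := hg m
    have shift : poch (a + n) (m + 1) = (a + n) * poch (a + (n + 1 : ℕ)) m := by
      rw [poch_succ_left, Nat.cast_succ, add_assoc]
    rw [Finset.sum_range_succ, ih, poch_neg_natCast_succ, shift]
    simp only [poch_succ]
    push_cast
    generalize poch (f + g - 1 - a) m = X at *
    field_simp
    ring

/-- The parameter `c = f + g - 1 - a` makes the sum balanced (Saalschützian). -/
theorem sum_saalschuetz (a f g : K) (hf : ∀ i : ℕ, f + i ≠ 0) (hg : ∀ i : ℕ, g + i ≠ 0)
    (n : ℕ) :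
    ∑ j ∈ Finset.range (n + 1), poch (-(n : K)) j * poch (a + n) j * poch (f + g - 1 - a) j /
        (poch 1 j * poch f j * poch g j) =
      poch (1 + a - f) n * poch (1 + a - g) n / (poch f n * poch g n) := by
  induction n with
  | zero => simp
  | succ n ih =>
    have recurrence := sum_saalschuetz_telescope a f g hf hg n (n + 1)
    have vanish : poch (-(n : K)) (n + 1) = 0 := poch_neg_natCast_of_lt n.lt_succ_self
    rw [vanish, Finset.sum_sub_distrib, ← Finset.mul_sum, ← Finset.mul_sum, zero_mul, zero_mul,
      mul_zero, zero_div, sub_eq_zero] at recurrence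
    have hfn := poch_ne_zero hf n
    have hgn := poch_ne_zero hg n
    refine mul_left_cancel₀ (mul_ne_zero (hf n) (hg n)) (recurrence.trans ?_)
    rw [Finset.sum_range_succ, vanish, ih]
    simp only [poch_succ, zero_mul, zero_div, add_zero]
    have hf' := hf n
    have hg' := hg n
    field_simp

end BalancedSums

section WellPoised

variable {K : Type*} [Field K]

/-- The factor `(b)_k / (1 + a - b)_k` of a term of a well-poised hypergeometric series with
leading parameter `a`; for `b = a` it is `(a)_k / k!`. -/
noncomputable def wellPoised (a b : K) (k : ℕ) : K := poch b k / poch (1 + a - b) k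

@[simp] lemma wellPoised_zero (a b : K) : wellPoised a b 0 = 1 := by simp [wellPoised]

lemma wellPoised_self (a : K) (k : ℕ) : wellPoised a a k = poch a k / poch 1 k := by
  rw [wellPoised, add_sub_cancel_right]

lemma wellPoised_neg (a b : K) (k : ℕ) :
    wellPoised a (-b) k = poch (-b) k / poch (1 + a + b) k := by
  rw [wellPoised, sub_neg_eq_add]

lemma wellPoised_add (a b : K) (j i : ℕ) :
    wellPoised a b (j + i) = wellPoised a b j * wellPoised (a + 2 * j) (b + j) i := by
  rw [wellPoised, wellPoised, wellPoised, poch_add, poch_add, mul_div_mul_comm]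
  ring_nf

/-- The factor which splits off when the summation index of a very-well-poised series is shifted
by `j`, see `veryWellPoised_shift`. -/
noncomputable def baileyWeight (a : K) (n j : ℕ) : K :=
  (-1) ^ j * poch a (2 * j) * wellPoised a (-n) j

lemma baileyWeight_mul {a : K} (ha : ∀ i : ℕ, 1 + a + i ≠ 0) {j n : ℕ} (h : j ≤ n) :
    baileyWeight a n j * ((a + 2 * j) * poch (1 + (a + 2 * j)) (n - j)) =
      a * poch (1 + a) n * ((-1) ^ j * poch (-(n : K)) j) := by
  obtain ⟨m, rfl⟩ := Nat.exists_eq_add_of_le h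
  have hn := poch_ne_zero (x := 1 + a + (j + m : ℕ)) (fun i => by
    simpa [add_assoc] using ha (j + m + i)) j
  have regroup : poch a (2 * j) * ((a + 2 * j) * poch (1 + (a + 2 * j)) m) =
      a * poch (1 + a) (j + m) * poch (1 + a + (j + m : ℕ)) j := by
    rw [mul_assoc a, ← poch_add, add_comm 1 a, ← poch_succ_left, add_comm 1 (a + 2 * (j : K)),
      ← poch_succ_left, show j + m + j + 1 = 2 * j + (m + 1) by omega, poch_add a (2 * j)]
    push_cast; rfl
  rw [baileyWeight, wellPoised_neg, Nat.add_sub_cancel_left, ← mul_div_assoc, div_mul_eq_mul_div,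
    div_eq_iff hn]
  linear_combination (-1) ^ j * poch (-((j + m : ℕ) : K)) j * regroup

variable [CharZero K]

lemma sum_wellPoised (a b : K) (hb : ∀ i : ℕ, 1 + a - b + i ≠ 0) (m : ℕ) :
    ∑ k ∈ Finset.range (m + 1), (a + 2 * k) * wellPoised a a k * wellPoised a b k =
      poch a (m + 1) * poch (1 + b) m / (poch 1 m * poch (1 + a - b) m) := by
  induction m with
  | zero => simp [poch_succ]
  | succ m ih =>
    have h1 := poch_one_ne_zero (R := K) m
    have hbm := poch_ne_zero hb m
    have h1' : (1 + m : K) ≠ 0 := by exact_mod_cast (by omega : 1 + m ≠ 0)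
    have hb' := hb m
    rw [Finset.sum_range_succ, ih, wellPoised_self, wellPoised, poch_succ_left b,
      add_comm b 1]
    simp only [poch_succ]
    push_cast
    field_simp
    ring

/-- The terms `(a + 2 * k) (a)_k (-n)_k / (k! (1 + a + n)_k)` of a terminating very-well-poised
series, the kernel of Bailey's lemma. -/
noncomputable def veryWellPoised (a : K) (n k : ℕ) : K :=
  (a + 2 * k) * wellPoised a a k * wellPoised a (-n) k

lemma sum_veryWellPoised {a : K} (ha : ∀ i : ℕ, 1 + a + i ≠ 0) (n : ℕ) :
    ∑ k ∈ Finset.range (n + 1), veryWellPoised a n k = if n = 0 then a else 0 := by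
  have hn : ∀ i : ℕ, 1 + a - (-(n : K)) + i ≠ 0 := fun i => by
    simpa [add_assoc] using ha (n + i)
  simp only [veryWellPoised, sum_wellPoised a (-(n : K)) hn]
  rcases n with _ | n
  · simp [poch_succ]
  · rw [Nat.cast_succ, neg_add_rev, add_neg_cancel_left, poch_neg_natCast_of_lt n.lt_succ_self]
    simp

/-- With `k = j + i` and `n = j + m`, this turns the double sum over `j ≤ k ≤ n` into a sum over `j`
of very-well-poised series. -/
lemma veryWellPoised_shift (a : K) (j m i : ℕ) :
    veryWellPoised a (j + m) (j + i) *
        (poch (-((j + i : ℕ) : K)) j * poch (a + (j + i : ℕ)) j) =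
      baileyWeight a (j + m) j * veryWellPoised (a + 2 * j) m i := by
  have h1 := poch_one_ne_zero (R := K) i
  have h2 := poch_one_ne_zero (R := K) (j + i)
  have reflect : poch (-((j + i : ℕ) : K)) j = (-1) ^ j * poch 1 (j + i) / poch 1 i := by
    rw [← poch_neg_natCast_mul, mul_div_cancel_right₀ _ h1]
  have regroup : poch a (j + i) * poch (a + (j + i : ℕ)) j =
      poch a (2 * j) * poch (a + 2 * j) i := by
    rw [← poch_add, show j + i + j = 2 * j + i by omega, poch_add]
    push_cast; rfl
  have tail : -((j + m : ℕ) : K) + j = -m := by push_cast; ring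
  simp only [veryWellPoised, baileyWeight, wellPoised_self, wellPoised_add, tail, reflect]
  push_cast at regroup ⊢
  field_simp
  linear_combination (a + 2 * (j + i)) * wellPoised a (-(j + m)) j *
    wellPoised (a + 2 * j) (-m) i * regroup

theorem bailey_transform (a : K) (n : ℕ) (c x : ℕ → K) :
    ∑ k ∈ Finset.range (n + 1), veryWellPoised a n k * x k *
        ∑ j ∈ Finset.range (k + 1), poch (-(k : K)) j * poch (a + k) j * c j =
      ∑ j ∈ Finset.range (n + 1), c j * baileyWeight a n j *
        ∑ i ∈ Finset.range (n - j + 1), veryWellPoised (a + 2 * j) (n - j) i * x (j + i) := by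
  let F : ℕ → ℕ → K := fun j i => veryWellPoised a n (j + i) * x (j + i) *
    (poch (-((j + i : ℕ) : K)) j * poch (a + (j + i : ℕ)) j * c j)
  calc _ = ∑ k ∈ Finset.range (n + 1), ∑ j ∈ Finset.range (k + 1), F j (k - j) := by
        refine Finset.sum_congr rfl fun k _ => ?_
        rw [Finset.mul_sum]
        refine Finset.sum_congr rfl fun j hj => ?_
        simp only [F, Nat.add_sub_cancel' (Finset.mem_range_succ_iff.1 hj)]
    _ = ∑ j ∈ Finset.range (n + 1), ∑ i ∈ Finset.range (n + 1 - j), F j i :=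
        Finset.sum_range_diag_flip _ _
    _ = _ := by
        refine Finset.sum_congr rfl fun j hj => ?_
        have hj := Finset.mem_range_succ_iff.1 hj
        rw [Nat.sub_add_comm hj, Finset.mul_sum]
        refine Finset.sum_congr rfl fun i _ => ?_
        have shift := veryWellPoised_shift a j (n - j) i
        rw [Nat.add_sub_cancel' hj] at shift
        linear_combination c j * x (j + i) * shift

/-- In `bailey_transform` with `x = 1` only the term `j = n` survives. -/
theorem bailey_lemma {a : K} (ha : ∀ i : ℕ, 1 + a + i ≠ 0) (n : ℕ) (c : ℕ → K) :
    ∑ k ∈ Finset.range (n + 1), veryWellPoised a n k *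
        ∑ j ∈ Finset.range (k + 1), poch (-(k : K)) j * poch (a + k) j * c j =
      a * poch (1 + a) n * poch 1 n * c n := by
  have transform := bailey_transform a n c 1
  simp only [Pi.one_apply, mul_one] at transform
  rw [transform, Finset.sum_eq_single_of_mem n (Finset.self_mem_range_succ n) fun j hj hjn => ?_]
  · have weight := baileyWeight_mul ha le_rfl (n := n)
    rw [poch_neg_natCast_self, ← mul_assoc ((-1) ^ n), ← mul_pow, neg_one_mul, neg_neg, one_pow,
      one_mul, Nat.sub_self, poch_zero, mul_one] at weight
    rw [Nat.sub_self, Finset.sum_range_one, veryWellPoised, wellPoised_zero,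
      wellPoised_zero]
    push_cast
    linear_combination c n * weight
  · have hj' := Finset.mem_range_succ_iff.1 hj
    have ha' : ∀ i : ℕ, 1 + (a + 2 * j) + i ≠ 0 := fun i => by
      simpa [add_assoc] using ha (2 * j + i)
    rw [sum_veryWellPoised ha', if_neg (by omega), mul_zero]

theorem sum_wellPoised_four {a b : K} (ha : ∀ i : ℕ, 1 + a + i ≠ 0)
    (hb : ∀ i : ℕ, 1 + a - b + i ≠ 0) (n : ℕ) :
    ∑ k ∈ Finset.range (n + 1), veryWellPoised a n k * ((-1) ^ k * wellPoised a b k) =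
      a * poch (1 + a) n / poch (1 + a - b) n := by
  have h1 := poch_one_ne_zero (R := K) n
  have vandermonde : ∀ k : ℕ, (-1) ^ k * wellPoised a b k = ∑ j ∈ Finset.range (k + 1),
      poch (-(k : K)) j * poch (a + k) j * (poch 1 j * poch (1 + a - b) j)⁻¹ := fun k => by
    have := sum_chuVandermonde (a + k) hb k
    rw [show 1 + a - b - (a + k) = 1 - k - b by ring, poch_reflect] at this
    simpa only [wellPoised, div_eq_mul_inv, mul_assoc] using this.symm
  simp only [vandermonde, bailey_lemma ha]
  field_simp

/-- The coefficients in the expansion `wellPoised_mul_wellPoised` of a product of two well-poised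
factors over the basis `k ↦ (-k)_j (a + k)_j`. -/
noncomputable def balancedCoeff (a b c : K) (j : ℕ) : K :=
  poch (1 + a - b - c) j / (poch 1 j * poch (1 + a - b) j * poch (1 + a - c) j)

lemma wellPoised_mul_wellPoised {a b c : K} (hb : ∀ i : ℕ, 1 + a - b + i ≠ 0)
    (hc : ∀ i : ℕ, 1 + a - c + i ≠ 0) (k : ℕ) :
    wellPoised a b k * wellPoised a c k = ∑ j ∈ Finset.range (k + 1),
      poch (-(k : K)) j * poch (a + k) j * balancedCoeff a b c j := by
  have saalschuetz := sum_saalschuetz a (1 + a - b) (1 + a - c) hb hc k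
  rw [sub_sub_cancel, sub_sub_cancel,
    show 1 + a - b + (1 + a - c) - 1 - a = 1 + a - b - c by ring] at saalschuetz
  rw [wellPoised, wellPoised, div_mul_div_comm, ← saalschuetz]
  simp only [balancedCoeff, mul_div_assoc]

theorem sum_wellPoised_five {a b c : K} (ha : ∀ i : ℕ, 1 + a + i ≠ 0)
    (hb : ∀ i : ℕ, 1 + a - b + i ≠ 0) (hc : ∀ i : ℕ, 1 + a - c + i ≠ 0) (n : ℕ) :
    ∑ k ∈ Finset.range (n + 1), veryWellPoised a n k * (wellPoised a b k * wellPoised a c k) =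
      a * poch (1 + a) n * poch (1 + a - b - c) n /
        (poch (1 + a - b) n * poch (1 + a - c) n) := by
  have h1 := poch_one_ne_zero (R := K) n
  simp only [wellPoised_mul_wellPoised hb hc, bailey_lemma ha, balancedCoeff]
  field_simp

lemma sum_veryWellPoised_shift {a d : K} (ha : ∀ i : ℕ, 1 + a + i ≠ 0)
    (hd : ∀ i : ℕ, 1 + a - d + i ≠ 0) {j n : ℕ} (hj : j ≤ n) :
    baileyWeight a n j * ∑ i ∈ Finset.range (n - j + 1),
        veryWellPoised (a + 2 * j) (n - j) i * ((-1) ^ (j + i) * wellPoised a d (j + i)) =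
      a * poch (1 + a) n / poch (1 + a - d) n * (poch d j * poch (-(n : K)) j) := by
  have ha' : ∀ i : ℕ, 1 + (a + 2 * j) + i ≠ 0 := fun i => by
    simpa [add_assoc] using ha (2 * j + i)
  have shift : 1 + (a + 2 * j) - (d + j) = 1 + a - d + j := by ring
  have hd' : ∀ i : ℕ, 1 + (a + 2 * j) - (d + j) + i ≠ 0 := fun i => by
    simpa [shift, add_assoc] using hd (j + i)
  have hdj := poch_ne_zero hd j
  have hdn : poch (1 + a - d + j) (n - j) ≠ 0 := shift ▸ poch_ne_zero hd' _
  have split : poch (1 + a - d) n = poch (1 + a - d) j * poch (1 + a - d + j) (n - j) := by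
    rw [← poch_add, Nat.add_sub_cancel' hj]
  have inner := sum_wellPoised_four ha' hd' (n - j)
  rw [shift] at inner
  have factor : ∀ i, veryWellPoised (a + 2 * j) (n - j) i *
      ((-1) ^ (j + i) * wellPoised a d (j + i)) = (-1) ^ j * wellPoised a d j *
        (veryWellPoised (a + 2 * j) (n - j) i *
          ((-1) ^ i * wellPoised (a + 2 * j) (d + j) i)) := fun i => by
    rw [pow_add, wellPoised_add]; ring
  have sign : ((-1 : K) ^ j) * (-1) ^ j = 1 := by rw [← mul_pow]; simp
  rw [Finset.sum_congr rfl fun i _ => factor i, ← Finset.mul_sum, inner, split, wellPoised]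
  field_simp
  linear_combination (-1) ^ j * poch d j * baileyWeight_mul ha hj +
    a * poch (1 + a) n * poch d j * poch (-(n : K)) j * sign

/-- Whipple's transformation of a terminating very-well-poised `₆F₅(-1)` into a `₃F₂(1)`. -/
theorem sum_wellPoised_six {a b c d : K} (ha : ∀ i : ℕ, 1 + a + i ≠ 0)
    (hb : ∀ i : ℕ, 1 + a - b + i ≠ 0) (hc : ∀ i : ℕ, 1 + a - c + i ≠ 0)
    (hd : ∀ i : ℕ, 1 + a - d + i ≠ 0) (n : ℕ) :
    ∑ k ∈ Finset.range (n + 1), veryWellPoised a n k * ((-1) ^ k * wellPoised a d k) *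
        (wellPoised a b k * wellPoised a c k) =
      a * poch (1 + a) n / poch (1 + a - d) n *
        ∑ j ∈ Finset.range (n + 1), poch d j * poch (-(n : K)) j * balancedCoeff a b c j := by
  simp only [wellPoised_mul_wellPoised hb hc, bailey_transform]
  rw [Finset.mul_sum]
  refine Finset.sum_congr rfl fun j hj => ?_
  rw [mul_assoc,
    sum_veryWellPoised_shift ha hd (Finset.mem_range_succ_iff.1 hj)]
  ring

end WellPoised

section Congruences

variable {p : ℕ} [Fact p.Prime] {n : ℕ} {a b c d : ℚ_[p]}

lemma natCast_padic_mem_subring (k : ℕ) : (k : ℚ_[p]) ∈ PadicInt.subring p := natCast_mem _ k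

lemma mem_subring_of_norm_eq_one (h : ‖a‖ = 1) : a ∈ PadicInt.subring p :=
  (PadicInt.mem_subring_iff p).2 h.le

lemma inv_mem_subring (h : ‖a‖ = 1) : a⁻¹ ∈ PadicInt.subring p :=
  mem_subring_of_norm_eq_one (by rw [norm_inv, h, inv_one])

lemma div_mem_subring (ha : a ∈ PadicInt.subring p) (hb : ‖b‖ = 1) :
    a / b ∈ PadicInt.subring p :=
  div_eq_mul_inv a b ▸ mul_mem ha (inv_mem_subring hb)

lemma ne_zero_of_norm_eq_one (h : ‖a‖ = 1) : a ≠ 0 :=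
  norm_ne_zero_iff.1 (h ▸ one_ne_zero)

namespace PadicModEq

lemma iff_exists_mem_subring :
    PadicModEq p n a b ↔ ∃ z ∈ PadicInt.subring p, a - b = (p : ℚ_[p]) ^ n * z :=
  ⟨fun ⟨z, hz⟩ => ⟨z, z.2, hz⟩, fun ⟨z, hz, h⟩ => ⟨⟨z, hz⟩, h⟩⟩

lemma of_eq (h : a = b) : PadicModEq p n a b := ⟨0, by simp [h]⟩

@[refl] lemma refl (a : ℚ_[p]) : PadicModEq p n a a := of_eq rfl

@[symm] lemma symm (h : PadicModEq p n a b) : PadicModEq p n b a := by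
  obtain ⟨z, hz⟩ := h
  exact ⟨-z, by rw [PadicInt.coe_neg, mul_neg, ← hz, neg_sub]⟩

lemma add (hab : PadicModEq p n a b) (hcd : PadicModEq p n c d) :
    PadicModEq p n (a + c) (b + d) := by
  obtain ⟨z, hz⟩ := hab
  obtain ⟨w, hw⟩ := hcd
  exact ⟨z + w, by rw [PadicInt.coe_add, mul_add, ← hz, ← hw]; ring⟩

@[trans] lemma trans (hab : PadicModEq p n a b) (hbc : PadicModEq p n b c) :
    PadicModEq p n a c := by
  obtain ⟨z, hz⟩ := hab
  obtain ⟨w, hw⟩ := hbc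
  exact ⟨z + w, by rw [PadicInt.coe_add, mul_add, ← hz, ← hw]; ring⟩

lemma const_mul (h : PadicModEq p n a b) (hc : c ∈ PadicInt.subring p) :
    PadicModEq p n (c * a) (c * b) := by
  obtain ⟨z, hz, h⟩ := iff_exists_mem_subring.1 h
  exact iff_exists_mem_subring.2 ⟨c * z, mul_mem hc hz, by rw [← mul_sub, h]; ring⟩

lemma sub (hab : PadicModEq p n a b) (hcd : PadicModEq p n c d) :
    PadicModEq p n (a - c) (b - d) := by
  simpa [sub_eq_add_neg] using hab.add (hcd.const_mul (neg_mem (one_mem _)))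

lemma sum {ι : Type*} {s : Finset ι} {f g : ι → ℚ_[p]}
    (h : ∀ i ∈ s, PadicModEq p n (f i) (g i)) :
    PadicModEq p n (∑ i ∈ s, f i) (∑ i ∈ s, g i) := by
  classical
  induction s using Finset.induction_on with
  | empty => rfl
  | insert i s hi ih =>
    rw [Finset.sum_insert hi, Finset.sum_insert hi]
    exact (h i (Finset.mem_insert_self i s)).add
      (ih fun j hj => h j (Finset.mem_insert_of_mem hj))

lemma mem_subring (h : PadicModEq p n a b) (hb : b ∈ PadicInt.subring p) :
    a ∈ PadicInt.subring p := by
  obtain ⟨z, hz, h⟩ := iff_exists_mem_subring.1 h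
  rw [eq_add_of_sub_eq h]
  exact add_mem (mul_mem (pow_mem (natCast_mem _ p) n) hz) hb

lemma mul (hab : PadicModEq p n a b) (hcd : PadicModEq p n c d) (hb : b ∈ PadicInt.subring p)
    (hd : d ∈ PadicInt.subring p) : PadicModEq p n (a * c) (b * d) :=
  (hcd.const_mul (hab.mem_subring hb)).trans
    (by simpa only [mul_comm _ d] using hab.const_mul hd)

lemma pow (h : PadicModEq p n a b) (hb : b ∈ PadicInt.subring p) (k : ℕ) :
    PadicModEq p n (a ^ k) (b ^ k) := by
  induction k with
  | zero => simpa using refl 1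
  | succ k ih => simpa only [pow_succ] using ih.mul h (pow_mem hb k) hb

lemma mono {m : ℕ} (h : PadicModEq p n a b) (hmn : m ≤ n) : PadicModEq p m a b := by
  obtain ⟨z, hz⟩ := h
  refine ⟨(p : ℤ_[p]) ^ (n - m) * z, ?_⟩
  rw [hz, PadicInt.coe_mul, PadicInt.coe_pow, PadicInt.coe_natCast, ← mul_assoc, ← pow_add,
    Nat.add_sub_cancel' hmn]

lemma norm_eq_one (h : PadicModEq p n a b) (hn : n ≠ 0) (hb : ‖b‖ = 1) : ‖a‖ = 1 := by
  obtain ⟨z, hz⟩ := h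
  have small : ‖a - b‖ < ‖b‖ := by
    rw [hz, hb, norm_mul, norm_pow]
    exact mul_lt_one_of_nonneg_of_lt_one_left (by positivity)
      (pow_lt_one₀ (norm_nonneg _) Padic.norm_p_lt_one hn) z.2
  rw [← hb, ← sub_add_cancel a b, Padic.add_eq_max_of_ne small.ne, max_eq_right small.le]

lemma inv_of_mul_eq_one (h : PadicModEq p n (a * b) 1) (ha : ‖a‖ = 1) : PadicModEq p n a⁻¹ b := by
  have := h.symm.const_mul (inv_mem_subring ha)
  rwa [mul_one, inv_mul_cancel_left₀ (ne_zero_of_norm_eq_one ha)] at this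

lemma inv (h : PadicModEq p n a b) (ha : ‖a‖ = 1) (hb : ‖b‖ = 1) : PadicModEq p n a⁻¹ b⁻¹ := by
  refine inv_of_mul_eq_one ?_ ha
  have := h.const_mul (inv_mem_subring hb)
  rwa [inv_mul_cancel₀ (ne_zero_of_norm_eq_one hb), mul_comm] at this

lemma div (hab : PadicModEq p n a b) (hcd : PadicModEq p n c d) (hb : b ∈ PadicInt.subring p)
    (hc : ‖c‖ = 1) (hd : ‖d‖ = 1) : PadicModEq p n (a / c) (b / d) := by
  rw [div_eq_mul_inv, div_eq_mul_inv]
  exact hab.mul (hcd.inv hc hd) hb (inv_mem_subring hd)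

lemma p_mul_iff : PadicModEq p (n + 1) (p * a) (p * b) ↔ PadicModEq p n a b := by
  have hp : (p : ℚ_[p]) ≠ 0 := Nat.cast_ne_zero.2 (Fact.out : p.Prime).ne_zero
  refine exists_congr fun z => ?_
  rw [← mul_sub, pow_succ', mul_assoc, mul_right_inj' hp]

end PadicModEq

end Congruences

section UnitExpansion

variable {p : ℕ} [Fact p.Prime] {F G : ℚ_[p] → ℚ_[p]} {A B u v : ℚ_[p]}

/-- `F t = A (1 + u (t p) + O((t p) ^ 2))` modulo `p ^ 3` with a `p`-adic unit `A`: since the second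
order coefficient does not depend on `t`, it cancels in the difference of `F 1` and `F (-1)`. -/
def HasUnitExpansion (F : ℚ_[p] → ℚ_[p]) (A u : ℚ_[p]) : Prop :=
  ‖A‖ = 1 ∧ u ∈ PadicInt.subring p ∧ ∃ c ∈ PadicInt.subring p, ∀ t ∈ PadicInt.subring p,
    PadicModEq p 3 (F t) (A * (1 + t * p * u + (t * p) ^ 2 * c))

namespace HasUnitExpansion

lemma expansion_norm_eq_one {t c : ℚ_[p]} (hu : u ∈ PadicInt.subring p)
    (hc : c ∈ PadicInt.subring p) (ht : t ∈ PadicInt.subring p) :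
    ‖1 + t * p * u + (t * p) ^ 2 * c‖ = 1 := by
  refine PadicModEq.norm_eq_one (n := 1) (b := 1) ?_ one_ne_zero norm_one
  refine PadicModEq.iff_exists_mem_subring.2 ⟨t * u + t ^ 2 * p * c, ?_, by ring⟩
  have := natCast_padic_mem_subring (p := p) p
  apply_rules [add_mem, mul_mem, sub_mem, neg_mem, pow_mem, one_mem]

lemma norm_eq_one (h : HasUnitExpansion F A u) {t : ℚ_[p]} (ht : t ∈ PadicInt.subring p) :
    ‖F t‖ = 1 := by
  obtain ⟨hA, hu, c, hc, h⟩ := h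
  refine (h t ht).norm_eq_one three_ne_zero ?_
  rw [norm_mul, hA, one_mul, expansion_norm_eq_one hu hc ht]

lemma const (hA : ‖A‖ = 1) : HasUnitExpansion (fun _ => A) A 0 :=
  ⟨hA, zero_mem _, 0, zero_mem _, fun t _ => .of_eq (by ring)⟩

lemma mul (hF : HasUnitExpansion F A u) (hG : HasUnitExpansion G B v) :
    HasUnitExpansion (fun t => F t * G t) (A * B) (u + v) := by
  have hp := natCast_padic_mem_subring (p := p) p
  obtain ⟨hA, hu, c, hc, hF⟩ := hF
  obtain ⟨hB, hv, d, hd, hG⟩ := hG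
  have hA' := mem_subring_of_norm_eq_one hA
  have hB' := mem_subring_of_norm_eq_one hB
  refine ⟨by rw [norm_mul, hA, hB, one_mul], add_mem hu hv, c + d + u * v,
    add_mem (add_mem hc hd) (mul_mem hu hv), fun t ht => ?_⟩
  refine ((hF t ht).mul (hG t ht) ?_ ?_).trans (PadicModEq.iff_exists_mem_subring.2
    ⟨A * B * (t ^ 3 * (u * d + c * v) + t ^ 4 * p * (c * d)), ?_, by ring⟩)
  all_goals apply_rules [add_mem, mul_mem, pow_mem, one_mem]

lemma pow (h : HasUnitExpansion F A u) (k : ℕ) :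
    HasUnitExpansion (fun t => F t ^ k) (A ^ k) (k * u) := by
  induction k with
  | zero => simpa using const norm_one
  | succ k ih => simpa only [pow_succ, Nat.cast_succ, add_one_mul] using ih.mul h

lemma inv (h : HasUnitExpansion F A u) : HasUnitExpansion (fun t => (F t)⁻¹) A⁻¹ (-u) := by
  have hp := natCast_padic_mem_subring (p := p) p
  have h2 := natCast_padic_mem_subring (p := p) 2
  push_cast at h2
  have unit : ∀ t ∈ PadicInt.subring p, ‖F t‖ = 1 := fun t => h.norm_eq_one
  obtain ⟨hA, hu, c, hc, h⟩ := h
  have hA' := inv_mem_subring hA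
  refine ⟨by rw [norm_inv, hA, inv_one], neg_mem hu, u ^ 2 - c, sub_mem (pow_mem hu 2) hc,
    fun t ht => PadicModEq.inv_of_mul_eq_one ?_ (unit t ht)⟩
  rw [mul_comm]
  refine ((h t ht).const_mul (mul_mem hA' ?_)).trans (PadicModEq.iff_exists_mem_subring.2
    ⟨t ^ 3 * (u ^ 3 - 2 * (u * c)) + t ^ 4 * p * (c * (u ^ 2 - c)), ?_, ?_⟩)
  · apply_rules [add_mem, mul_mem, sub_mem, neg_mem, pow_mem, one_mem]
  · apply_rules [add_mem, mul_mem, sub_mem, pow_mem]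
  · have := ne_zero_of_norm_eq_one hA
    field_simp
    ring

lemma div (hF : HasUnitExpansion F A u) (hG : HasUnitExpansion G B v) :
    HasUnitExpansion (fun t => F t / G t) (A / B) (u - v) := by
  simpa only [div_eq_mul_inv, sub_eq_add_neg] using hF.mul hG.inv

lemma modEq_sq (h : HasUnitExpansion F A u) {t : ℚ_[p]} (ht : t ∈ PadicInt.subring p) :
    PadicModEq p 2 (F t) (A * (1 + t * p * u)) := by
  obtain ⟨hA, -, c, hc, h⟩ := h
  exact ((h t ht).mono (by norm_num)).trans (PadicModEq.iff_exists_mem_subring.2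
    ⟨A * (t ^ 2 * c), mul_mem (mem_subring_of_norm_eq_one hA) (mul_mem (pow_mem ht 2) hc), by ring⟩)

lemma modEq_of_apply_neg_one (h : HasUnitExpansion F A u) (hA : F (-1) = A) {t : ℚ_[p]}
    (ht : t ∈ PadicInt.subring p) : PadicModEq p 2 (F t) A := by
  have linear := (h.modEq_sq (neg_mem (one_mem (PadicInt.subring p)))).const_mul ht
  rw [hA] at linear
  convert (h.modEq_sq ht).add linear |>.sub (.refl (t * A)) using 1 <;> ring

lemma mul_apply_neg_one (h : HasUnitExpansion F A u) : PadicModEq p 2 (F 1 * F (-1)) (A ^ 2) := by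
  obtain ⟨hA, hu, -⟩ := id h
  have hA' := mem_subring_of_norm_eq_one hA
  have hp := natCast_padic_mem_subring (p := p) p
  have unit : ∀ t ∈ PadicInt.subring p, A * (1 + t * p * u) ∈ PadicInt.subring p := fun t ht =>
    mul_mem hA' (add_mem (one_mem _) (mul_mem (mul_mem ht hp) hu))
  have one := one_mem (PadicInt.subring p)
  refine ((h.modEq_sq one).mul (h.modEq_sq (neg_mem one)) (unit 1 one)
    (unit (-1) (neg_mem one))).trans (PadicModEq.iff_exists_mem_subring.2
      ⟨-(A ^ 2 * u ^ 2), neg_mem (mul_mem (pow_mem hA' 2) (pow_mem hu 2)), by ring⟩)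

lemma congr (hF : HasUnitExpansion F A u) (hG : HasUnitExpansion G B v) (hAB : A = B)
    (huv : u = v) : PadicModEq p 2 (F 1) (G 1) := by
  subst hAB huv
  exact (hF.modEq_sq (one_mem _)).trans (hG.modEq_sq (one_mem _)).symm

lemma central_difference (h : HasUnitExpansion F A u) {w : ℚ_[p]} (hw : w ∈ PadicInt.subring p) :
    PadicModEq p 3 ((w + p) * F 1 - (w - p) * F (-1)) (p * (2 * A * (1 + w * u))) := by
  have hp := natCast_padic_mem_subring (p := p) p
  have h2 := natCast_padic_mem_subring (p := p) 2
  push_cast at h2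
  obtain ⟨hA, -, c, hc, h⟩ := h
  have hA' := mem_subring_of_norm_eq_one hA
  exact (((h 1 (one_mem _)).const_mul (add_mem hw hp)).sub
    ((h (-1) (neg_mem (one_mem _))).const_mul (sub_mem hw hp))).trans
    (PadicModEq.iff_exists_mem_subring.2 ⟨2 * (A * c), mul_mem h2 (mul_mem hA' hc), by ring⟩)

end HasUnitExpansion

end UnitExpansion

section PochExpansion

variable {p : ℕ} [Fact p.Prime]

/-- The logarithmic derivative of `x ↦ (x)_k`. -/
def pochLogDeriv {K : Type*} [Field K] (x : K) (k : ℕ) : K := ∑ i ∈ Finset.range k, (x + i)⁻¹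

lemma pochLogDeriv_one (k : ℕ) : pochLogDeriv (1 : ℚ_[p]) k = harmonic k := by
  simp [pochLogDeriv, harmonic, add_comm]

lemma norm_poch_eq_one {x : ℚ_[p]} {k : ℕ} (hx : ∀ i < k, ‖x + i‖ = 1) : ‖poch x k‖ = 1 := by
  rw [poch_eq_prod, norm_prod]
  exact Finset.prod_eq_one fun i hi => hx i (Finset.mem_range.1 hi)

lemma poch_mem_subring {x : ℚ_[p]} (hx : x ∈ PadicInt.subring p) (k : ℕ) :
    poch x k ∈ PadicInt.subring p :=
  poch_eq_prod x k ▸ prod_mem fun i _ => add_mem hx (natCast_mem _ i)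

lemma hasUnitExpansion_linear {x s : ℚ_[p]} (hx : ‖x‖ = 1) (hs : s ∈ PadicInt.subring p) :
    HasUnitExpansion (fun t : ℚ_[p] => x + t * (s * p)) x (s * x⁻¹) := by
  refine ⟨hx, mul_mem hs (inv_mem_subring hx), 0, zero_mem _, fun t _ => .of_eq ?_⟩
  have := ne_zero_of_norm_eq_one hx
  field_simp
  ring

lemma hasUnitExpansion_poch {x s : ℚ_[p]} {k : ℕ} (hx : ∀ i < k, ‖x + i‖ = 1)
    (hs : s ∈ PadicInt.subring p) :
    HasUnitExpansion (fun t : ℚ_[p] => poch (x + t * (s * p)) k) (poch x k)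
      (s * pochLogDeriv x k) := by
  induction k with
  | zero => simpa [pochLogDeriv] using HasUnitExpansion.const (p := p) norm_one
  | succ k ih =>
    convert (ih fun i hi => hx i (hi.trans k.lt_succ_self)).mul
      (hasUnitExpansion_linear (hx k k.lt_succ_self) hs) using 1
    · ext t
      rw [poch_succ, add_right_comm]
    · rw [poch_succ]
    · rw [pochLogDeriv, Finset.sum_range_succ, mul_add, ← pochLogDeriv]

lemma hasUnitExpansion_wellPoised {a b r s : ℚ_[p]} {k : ℕ} (hb : ∀ i < k, ‖b + i‖ = 1)
    (hab : ∀ i < k, ‖1 + a - b + i‖ = 1) (hr : r ∈ PadicInt.subring p)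
    (hs : s ∈ PadicInt.subring p) :
    HasUnitExpansion (fun t : ℚ_[p] => wellPoised (a + t * (r * p)) (b + t * (s * p)) k)
      (wellPoised a b k) (s * pochLogDeriv b k - (r - s) * pochLogDeriv (1 + a - b) k) := by
  convert (hasUnitExpansion_poch hb hs).div (hasUnitExpansion_poch hab (sub_mem hr hs)) using 2
  · rw [wellPoised]
    ring_nf
  · rw [wellPoised]

end PochExpansion

section Reduction

lemma wellPoised_reflect {K : Type*} [Field K] {b : K} {j k : ℕ} (hb : poch b (j + k) ≠ 0) :
    wellPoised (-((j + k : ℕ) : K)) b j =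
      (-1) ^ (j + k) * wellPoised (-((j + k : ℕ) : K)) b k := by
  have hj : poch b j ≠ 0 := left_ne_zero_of_mul (poch_add b j k ▸ hb)
  have hk : poch b k ≠ 0 := left_ne_zero_of_mul (poch_add b k j ▸ add_comm j k ▸ hb)
  have reflect_k := poch_reflect_mul b j k
  have reflect_j := poch_reflect_mul b k j
  rw [add_comm k j] at reflect_j
  rw [wellPoised, wellPoised, ← sub_eq_add_neg, eq_div_of_mul_eq hj reflect_k,
    eq_div_of_mul_eq hk reflect_j, pow_add]
  field_simp
  rw [← pow_mul, mul_comm, pow_mul, neg_one_sq, one_pow]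

lemma sum_eq_zero_of_symm {K : Type*} [Field K] [CharZero K] {n : ℕ} {f : ℕ → K}
    (hf : ∀ j k, j + k = n → f j = f k) :
    ∑ k ∈ Finset.range (n + 1), (-(n : K) + 2 * k) * f k = 0 := by
  refine self_eq_neg.1 ?_
  rw [← Finset.sum_neg_distrib, ← Finset.sum_range_reflect]
  refine Finset.sum_congr rfl fun k hk => ?_
  have hk := Finset.mem_range_succ_iff.1 hk
  rw [Nat.add_sub_cancel, hf (n - k) k (Nat.sub_add_cancel hk), Nat.cast_sub hk]
  ring

/-- The factors of a summand whose leading parameter is `(1 + t p) / 2`. At `t = 1` and `t = -1` one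
of the upper parameters is `-(p - 1) / 2`, so that the series terminates. -/
noncomputable def halfFactors (p m k : ℕ) [Fact p.Prime] (t : ℚ_[p]) : ℚ_[p] :=
  wellPoised (1 / 2 + t * (1 / 2 * p)) (1 / 2 + t * (1 / 2 * p)) k *
    wellPoised (1 / 2 + t * (1 / 2 * p)) (1 / 2 + t * (-(1 / 2) * p)) k *
    (wellPoised (1 / 2 + t * (1 / 2 * p)) (1 / 2) k ^ m * ((-1) ^ m) ^ k)

/-- The summand of the harmonic sum of degree `m + 2` in the central binomial coefficients. -/
def harmonicTerm (m k : ℕ) : ℚ :=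
  ((2 * k).choose k / 4 ^ k) ^ (m + 2) * (2 - (m + 2) * (4 * k + 1) * harmonic k) * ((-1) ^ m) ^ k

variable {p : ℕ} [Fact p.Prime] {n : ℕ}

lemma norm_natCast_eq_one {k : ℕ} (hk : 0 < k) (hkp : k < p) : ‖(k : ℚ_[p])‖ = 1 :=
  Padic.norm_natCast_eq_one_iff.2 (Nat.coprime_of_lt_prime hk.ne' hkp Fact.out)

lemma norm_div_add_natCast_eq_one {u v i : ℕ} (hv : ‖(v : ℚ_[p])‖ = 1)
    (h : p.Coprime (u + v * i)) : ‖(u / v + i : ℚ_[p])‖ = 1 := by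
  have hv0 := ne_zero_of_norm_eq_one hv
  rw [div_add' _ _ _ hv0, norm_div, hv, div_one, mul_comm]
  exact_mod_cast Padic.norm_natCast_eq_one_iff.2 h

lemma norm_one_add_natCast_eq_one {i : ℕ} (hi : i + 1 < p) : ‖(1 + i : ℚ_[p])‖ = 1 := by
  simpa [add_comm] using norm_natCast_eq_one i.succ_pos hi

lemma natCast_eq_two_mul_add_one (hp : p = 2 * n + 1) : (p : ℚ_[p]) = 2 * n + 1 := by
  exact_mod_cast congrArg (Nat.cast (R := ℚ_[p])) hp

lemma norm_two_eq_one (hp : p = 2 * n + 1) : ‖(2 : ℚ_[p])‖ = 1 := by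
  have := (Fact.out : p.Prime).two_le
  exact_mod_cast norm_natCast_eq_one (p := p) two_pos (by omega)

lemma norm_four_pow_eq_one (hp : p = 2 * n + 1) (k : ℕ) : ‖(4 ^ k : ℚ_[p])‖ = 1 := by
  rw [show (4 : ℚ_[p]) = 2 ^ 2 by norm_num]
  simp [norm_two_eq_one hp]

lemma norm_half_add_natCast_eq_one (hp : p = 2 * n + 1) {i : ℕ} (hi : i < n) :
    ‖(1 / 2 + i : ℚ_[p])‖ = 1 := by
  have h2 := norm_two_eq_one hp
  exact_mod_cast norm_div_add_natCast_eq_one (u := 1) (v := 2) (mod_cast h2)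
    (Nat.coprime_of_lt_prime (by omega) (by omega) Fact.out)

lemma half_mem_subring (hp : p = 2 * n + 1) : (1 / 2 : ℚ_[p]) ∈ PadicInt.subring p :=
  div_mem_subring (one_mem _) (norm_two_eq_one hp)

lemma harmonic_mem_subring {k : ℕ} (hk : k < p) :
    ((harmonic k : ℚ) : ℚ_[p]) ∈ PadicInt.subring p :=
  pochLogDeriv_one (p := p) k ▸ sum_mem fun i hi =>
    inv_mem_subring (norm_one_add_natCast_eq_one (by have := Finset.mem_range.1 hi; omega))

lemma centralBinom_div_four_pow {K : Type*} [Field K] [CharZero K] (k : ℕ) :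
    ((2 * k).choose k : K) / 4 ^ k = wellPoised (1 / 2) (1 / 2) k := by
  rw [wellPoised_self]
  induction k with
  | zero => simp
  | succ k ih =>
    have recurrence : ((k : K) + 1) * ((2 * (k + 1)).choose (k + 1) : K) =
        2 * (2 * k + 1) * ((2 * k).choose k : K) := by
      exact_mod_cast Nat.succ_mul_centralBinom_succ k
    have hk : (k : K) + 1 ≠ 0 := by exact_mod_cast k.succ_ne_zero
    have h1 := poch_one_ne_zero (R := K) k
    have h1' := poch_one_ne_zero (R := K) (k + 1)
    rw [div_eq_div_iff (by simp) h1] at ih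
    rw [div_eq_div_iff (by simp) h1', poch_succ, poch_succ, pow_succ]
    refine mul_left_cancel₀ hk ?_
    linear_combination poch 1 k * (1 + k) * recurrence + (2 * (2 * k + 1)) * (1 + k) * ih

lemma hasUnitExpansion_halfFactors (hp : p = 2 * n + 1) (m : ℕ) {k : ℕ} (hk : k ≤ n) :
    HasUnitExpansion (halfFactors p m k) (wellPoised (1 / 2) (1 / 2) k ^ (m + 2) * ((-1) ^ m) ^ k)
      (-(1 + m / 2) * harmonic k) := by
  have half := half_mem_subring hp
  have unit : ∀ i < k, ‖(1 / 2 + i : ℚ_[p])‖ = 1 := fun i hi =>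
    norm_half_add_natCast_eq_one hp (hi.trans_le hk)
  have unit' : ∀ i < k, ‖(1 + 1 / 2 - 1 / 2 + i : ℚ_[p])‖ = 1 := fun i hi => by
    rw [add_sub_cancel_right]
    exact norm_one_add_natCast_eq_one (by omega)
  have factor : ∀ s ∈ PadicInt.subring p, _ := fun s hs =>
    hasUnitExpansion_wellPoised unit unit' half hs
  have main := ((factor _ half).mul (factor _ (neg_mem half))).mul
    (((factor 0 (zero_mem _)).pow m).mul (.const (A := ((-1) ^ m) ^ k) (by simp)))
  simp only [zero_mul, mul_zero, add_zero, add_sub_cancel_right, pochLogDeriv_one] at main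
  convert main using 1
  · rfl
  · ring
  · ring

/-- A difference of halved terms at `t = 1` and `t = -1` extracts the derivative in the leading
parameter, which is where the harmonic numbers come from. -/
lemma p_mul_harmonicTerm_modEq (hp : p = 2 * n + 1) (m : ℕ) {k : ℕ} (hk : k ≤ n) :
    PadicModEq p 3
      (p * harmonicTerm m k)
      (2 * ((n + 1 + 2 * k) * halfFactors p m k 1) -
        2 * ((-n + 2 * k) * halfFactors p m k (-1))) := by
  have hp' := natCast_eq_two_mul_add_one hp
  have weight : (4 * k + 1 : ℚ_[p]) ∈ PadicInt.subring p := by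
    exact_mod_cast natCast_padic_mem_subring (p := p) (4 * k + 1)
  convert ((hasUnitExpansion_halfFactors hp m hk).central_difference weight).symm using 1
  · rw [harmonicTerm, ← centralBinom_div_four_pow]
    push_cast
    ring
  · rw [hp']
    ring

lemma halfFactors_neg_one_symm (hp : p = 2 * n + 1) (m : ℕ) {j k : ℕ} (hjk : j + k = n) :
    halfFactors p m j (-1) = halfFactors p m k (-1) := by
  have half := half_mem_subring hp
  have unit : ∀ i < n, ‖(1 / 2 + i : ℚ_[p])‖ = 1 := fun i hi => norm_half_add_natCast_eq_one hp hi
  have ne_zero : ∀ s ∈ PadicInt.subring p, poch (1 / 2 + -1 * (s * p)) n ≠ 0 := fun s hs =>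
    ne_zero_of_norm_eq_one ((hasUnitExpansion_poch unit hs).norm_eq_one (neg_mem (one_mem _)))
  have lead : (1 / 2 + -1 * (1 / 2 * p) : ℚ_[p]) = -((j + k : ℕ) : ℚ_[p]) := by
    rw [natCast_eq_two_mul_add_one hp, hjk]
    ring
  have third := ne_zero 0 (zero_mem _)
  rw [zero_mul, mul_zero, add_zero] at third
  subst hjk
  have first := wellPoised_reflect (ne_zero _ half)
  have second := wellPoised_reflect (ne_zero _ (neg_mem half))
  rw [halfFactors, halfFactors]
  rw [lead] at first ⊢
  rw [first, second, wellPoised_reflect third, mul_pow]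
  have sign : ((-1 : ℚ_[p]) ^ (j + k)) ^ m * ((-1) ^ m) ^ j = ((-1) ^ m) ^ k := by
    rw [← pow_mul, ← pow_mul, ← pow_mul, ← pow_add, mul_comm (j + k), mul_add, add_right_comm,
      pow_add, ← two_mul, pow_mul, neg_one_sq, one_pow, one_mul]
  have sign' : ((-1 : ℚ_[p]) ^ (j + k)) * (-1) ^ (j + k) = 1 := by rw [← mul_pow]; simp
  linear_combination wellPoised (-((j + k : ℕ) : ℚ_[p])) (-((j + k : ℕ) : ℚ_[p])) k *
    wellPoised (-((j + k : ℕ) : ℚ_[p])) (1 / 2 + -1 * (-(1 / 2) * p)) k *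
    wellPoised (-((j + k : ℕ) : ℚ_[p])) (1 / 2) k ^ m *
      ((-1) ^ (j + k) * (-1) ^ (j + k) * sign + ((-1) ^ m) ^ k * sign')

lemma sum_range_modEq_of_modEq_zero {f : ℕ → ℚ_[p]} {l u : ℕ} (hl : l ≤ u)
    (hf : ∀ k, l ≤ k → k < u → PadicModEq p n (f k) 0) :
    PadicModEq p n (∑ k ∈ Finset.range u, f k) (∑ k ∈ Finset.range l, f k) := by
  have tail := PadicModEq.sum (s := Finset.Ico l u) fun k hk =>
    hf k (Finset.mem_Ico.1 hk).1 (Finset.mem_Ico.1 hk).2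
  rw [Finset.sum_const_zero] at tail
  simpa only [Finset.sum_range_add_sum_Ico f hl, add_zero] using
    (PadicModEq.refl (∑ k ∈ Finset.range l, f k)).add tail

lemma dvd_choose_two_mul {k : ℕ} (hk : p ≤ 2 * k) (hkp : k < p) : p ∣ (2 * k).choose k := by
  have hp : p.Prime := Fact.out
  have dvd : p ∣ (2 * k).choose k * k.factorial * (2 * k - k).factorial :=
    Nat.choose_mul_factorial_mul_factorial (Nat.le_mul_of_pos_left k two_pos) ▸
      hp.dvd_factorial.2 hk
  have not_dvd : ¬p ∣ k.factorial := fun h => hkp.not_ge (hp.dvd_factorial.1 h)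
  rw [two_mul, Nat.add_sub_cancel, ← two_mul] at dvd
  exact (hp.dvd_mul.1 ((hp.dvd_mul.1 dvd).resolve_right not_dvd)).resolve_right not_dvd

lemma harmonicTerm_modEq_zero (hp : p = 2 * n + 1) (m : ℕ) {k : ℕ} (hk : n + 1 ≤ k) (hkp : k < p) :
    PadicModEq p 2 (harmonicTerm m k) 0 := by
  obtain ⟨c, hc⟩ := dvd_choose_two_mul (p := p) (k := k) (by omega) hkp
  have nat : ∀ i : ℕ, (i : ℚ_[p]) ∈ PadicInt.subring p := natCast_padic_mem_subring
  have weight : (2 - (m + 2) * (4 * k + 1) * harmonic k : ℚ_[p]) ∈ PadicInt.subring p :=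
    sub_mem (mod_cast nat 2) (mul_mem (mod_cast nat ((m + 2) * (4 * k + 1)))
      (harmonic_mem_subring hkp))
  refine PadicModEq.iff_exists_mem_subring.2 ⟨(c / 4 ^ k) ^ 2 * ((p * c : ℕ) / 4 ^ k) ^ m *
    (2 - (m + 2) * (4 * k + 1) * harmonic k) * ((-1) ^ m) ^ k, ?_, ?_⟩
  · have quot : ∀ i : ℕ, (i / 4 ^ k : ℚ_[p]) ∈ PadicInt.subring p := fun i =>
      div_mem_subring (nat i) (norm_four_pow_eq_one hp k)
    exact mul_mem (mul_mem (mul_mem (pow_mem (quot c) 2) (pow_mem (quot (p * c)) m)) weight)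
      (pow_mem (pow_mem (neg_mem (one_mem _)) m) k)
  · rw [harmonicTerm, hc]
    push_cast
    ring

theorem harmonicSum_modEq (hp : p = 2 * n + 1) (m : ℕ) :
    PadicModEq p 3
      (p * (∑ k ∈ Finset.range p, harmonicTerm m k : ℚ))
      (2 * ∑ k ∈ Finset.range (n + 1), veryWellPoised (n + 1 : ℚ_[p]) n k *
        (wellPoised (n + 1 : ℚ_[p]) (1 / 2) k ^ m * ((-1) ^ m) ^ k)) := by
  have truncate := sum_range_modEq_of_modEq_zero (l := n + 1) (u := p) (by omega) fun k hk hkp =>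
    harmonicTerm_modEq_zero hp m hk hkp
  have vanish := sum_eq_zero_of_symm (n := n) (f := fun k => halfFactors p m k (-1))
    fun j k => halfFactors_neg_one_symm hp m
  have differences := PadicModEq.sum (s := Finset.range (n + 1)) fun k hk =>
    p_mul_harmonicTerm_modEq hp m (Finset.mem_range_succ_iff.1 hk)
  rw [← Finset.mul_sum, Finset.sum_sub_distrib, ← Finset.mul_sum, ← Finset.mul_sum, vanish,
    mul_zero, sub_zero] at differences
  rw [Rat.cast_sum]
  refine (PadicModEq.p_mul_iff.2 truncate).trans (differences.trans (.of_eq ?_))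
  have lead : (1 / 2 + 1 * (1 / 2 * p) : ℚ_[p]) = n + 1 := by
    rw [natCast_eq_two_mul_add_one hp]; ring
  have neg : (1 / 2 + 1 * (-(1 / 2) * p) : ℚ_[p]) = -n := by
    rw [natCast_eq_two_mul_add_one hp]; ring
  simp only [halfFactors, lead, neg, veryWellPoised, mul_assoc]

end Reduction

section ClosedForms

lemma poch_double {K : Type*} [Field K] [CharZero K] (x : K) (k : ℕ) :
    poch x (2 * k) = 4 ^ k * (poch (x / 2) k * poch ((x + 1) / 2) k) := by
  induction k with
  | zero => simp
  | succ k ih =>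
    rw [show 2 * (k + 1) = 2 * k + 1 + 1 by ring, poch_succ, poch_succ, ih, poch_succ, poch_succ]
    push_cast
    ring

lemma poch_natCast_succ_mul {R : Type*} [CommRing R] (j k : ℕ) :
    poch (j + 1 : R) k * poch 1 j = poch 1 (j + k) := by
  rw [poch_add, mul_comm, add_comm (j : R)]

variable {p : ℕ} [Fact p.Prime] {n : ℕ}

/-- The quotient `(p - 1)! / (n! (1 + p / 2)_n)` with `p = 2 n + 1`. -/
noncomputable def halfQuot (p : ℕ) [Fact p.Prime] (n : ℕ) : ℚ_[p] :=
  poch (1 : ℚ_[p]) (2 * n) / (poch (1 : ℚ_[p]) n * poch (1 + 1 / 2 * p : ℚ_[p]) n)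

lemma succ_mul_poch_div_eq_p_mul_halfQuot (hp : p = 2 * n + 1) :
    (n + 1 : ℚ_[p]) * poch (1 + (n + 1 : ℚ_[p])) n / poch (1 + 1 / 2 * p : ℚ_[p]) n =
      p * halfQuot p n := by
  have h1 := poch_one_ne_zero (R := ℚ_[p]) n
  have factorial : (n + 1 : ℚ_[p]) * poch (1 + (n + 1 : ℚ_[p])) n * poch 1 n =
      p * poch 1 (2 * n) := by
    rw [add_comm 1, ← poch_succ_left, poch_natCast_succ_mul, ← add_assoc, ← two_mul, poch_succ,
      natCast_eq_two_mul_add_one hp]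
    push_cast
    ring
  rw [halfQuot, ← mul_div_assoc, ← factorial, mul_comm (poch 1 n), mul_div_mul_right _ _ h1]

lemma one_add_succ_add_ne_zero (n i : ℕ) : 1 + (n + 1 : ℚ_[p]) + i ≠ 0 := by
  exact_mod_cast (by omega : 1 + (n + 1) + i ≠ 0)

lemma one_add_succ_sub_half (hp : p = 2 * n + 1) :
    1 + (n + 1 : ℚ_[p]) - 1 / 2 = 1 + 1 / 2 * p := by
  rw [natCast_eq_two_mul_add_one hp]
  ring

lemma one_add_succ_sub_half_add_ne_zero (n i : ℕ) : 1 + (n + 1 : ℚ_[p]) - 1 / 2 + i ≠ 0 := by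
  have : ((n + i + 3 / 2 : ℚ) : ℚ_[p]) ≠ 0 := Rat.cast_ne_zero.2 (by positivity)
  convert this using 1
  push_cast
  ring

lemma harmonicSum_one_modEq (hp : p = 2 * n + 1) :
    PadicModEq p 2 (∑ k ∈ Finset.range p, harmonicTerm 1 k : ℚ) (2 * halfQuot p n) := by
  refine PadicModEq.p_mul_iff.1 ((harmonicSum_modEq hp 1).trans (.of_eq ?_))
  have four := sum_wellPoised_four (one_add_succ_add_ne_zero (p := p) n)
    (one_add_succ_sub_half_add_ne_zero n) n
  rw [one_add_succ_sub_half hp, succ_mul_poch_div_eq_p_mul_halfQuot hp] at four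
  rw [mul_left_comm, ← four]
  simp only [pow_one, mul_comm]

lemma harmonicSum_two_modEq (hp : p = 2 * n + 1) :
    PadicModEq p 2 (∑ k ∈ Finset.range p, harmonicTerm 2 k : ℚ) (2 * halfQuot p n ^ 2) := by
  refine PadicModEq.p_mul_iff.1 ((harmonicSum_modEq hp 2).trans (.of_eq ?_))
  have hb := one_add_succ_sub_half_add_ne_zero (p := p) n
  have five := sum_wellPoised_five (one_add_succ_add_ne_zero (p := p) n) hb hb n
  have last : poch (n + 1 : ℚ_[p]) n / poch (1 + 1 / 2 * p : ℚ_[p]) n = halfQuot p n := by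
    rw [halfQuot, two_mul, ← poch_natCast_succ_mul, mul_comm (poch 1 n),
      mul_div_mul_right _ _ (poch_one_ne_zero n)]
  rw [one_add_succ_sub_half hp, mul_div_mul_comm, succ_mul_poch_div_eq_p_mul_halfQuot hp,
    ← one_add_succ_sub_half hp, sub_sub, add_halves, add_sub_cancel_left,
    one_add_succ_sub_half hp, last] at five
  rw [mul_left_comm, sq (halfQuot p n), ← mul_assoc (p : ℚ_[p]), ← five]
  simp only [sq, mul_neg, mul_one, neg_neg, one_pow]

/-- The `₃F₂(1)` with upper parameters `(1 + p) / 2`, `(1 - p) / 2`, `1 / 2` and lower parameters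
`1 + p / 2`, `1 + p / 2`, with `p = 2 n + 1`. -/
noncomputable def halfThreeFTwo (p : ℕ) [Fact p.Prime] (n : ℕ) : ℚ_[p] :=
  ∑ j ∈ Finset.range (n + 1), poch (1 / 2 : ℚ_[p]) j * poch (-n : ℚ_[p]) j *
    balancedCoeff (n + 1 : ℚ_[p]) (1 / 2) (1 / 2) j

lemma harmonicSum_three_modEq (hp : p = 2 * n + 1) :
    PadicModEq p 2 (∑ k ∈ Finset.range p, harmonicTerm 3 k : ℚ)
      (2 * (halfQuot p n * halfThreeFTwo p n)) := by
  refine PadicModEq.p_mul_iff.1 ((harmonicSum_modEq hp 3).trans (.of_eq ?_))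
  have hb := one_add_succ_sub_half_add_ne_zero (p := p) n
  have six := sum_wellPoised_six (one_add_succ_add_ne_zero (p := p) n) hb hb hb n
  rw [one_add_succ_sub_half hp, succ_mul_poch_div_eq_p_mul_halfQuot hp] at six
  rw [mul_left_comm, ← mul_assoc (p : ℚ_[p]), halfThreeFTwo, ← six]
  congr 2 with k
  rw [pow_succ (-1 : ℚ_[p]), neg_one_sq]
  ring

lemma norm_poch_one_eq_one {k : ℕ} (hk : k < p) : ‖poch (1 : ℚ_[p]) k‖ = 1 :=
  norm_poch_eq_one fun _ hi => norm_one_add_natCast_eq_one (by omega)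

lemma hasUnitExpansion_poch_one {s : ℚ_[p]} {k : ℕ} (hk : k < p) (hs : s ∈ PadicInt.subring p) :
    HasUnitExpansion (fun t : ℚ_[p] => poch (1 + t * (s * p)) k) (poch 1 k)
      (s * pochLogDeriv 1 k) :=
  hasUnitExpansion_poch (fun _ hi => norm_one_add_natCast_eq_one (by omega)) hs

lemma norm_poch_one_add_mul_prime_eq_one {s : ℚ_[p]} {k : ℕ} (hk : k < p)
    (hs : s ∈ PadicInt.subring p) : ‖poch (1 + s * p) k‖ = 1 := by
  simpa only [one_mul] using (hasUnitExpansion_poch_one hk hs).norm_eq_one (one_mem _)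

lemma norm_poch_one_sub_mul_prime_eq_one {s : ℚ_[p]} {k : ℕ} (hk : k < p)
    (hs : s ∈ PadicInt.subring p) : ‖poch (1 - s * p) k‖ = 1 := by
  simpa only [neg_mul, ← sub_eq_add_neg] using
    norm_poch_one_add_mul_prime_eq_one hk (neg_mem hs)

lemma poch_one_sub_prime (hp : p = 2 * n + 1) :
    poch (1 - p : ℚ_[p]) (2 * n) = poch 1 (2 * n) := by
  have reflect := poch_reflect (1 : ℚ_[p]) (2 * n)
  rw [pow_mul, neg_one_sq, one_pow, one_mul] at reflect
  rw [← reflect, natCast_eq_two_mul_add_one hp]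
  push_cast
  ring_nf

lemma poch_one_add_mul_prime_modEq (hp : p = 2 * n + 1) {t : ℚ_[p]}
    (ht : t ∈ PadicInt.subring p) :
    PadicModEq p 2 (poch (1 + t * p) (2 * n)) (poch 1 (2 * n)) := by
  have expansion := hasUnitExpansion_poch_one (p := p) (k := 2 * n) (by omega) (one_mem _)
  simp only [one_mul] at expansion
  refine expansion.modEq_of_apply_neg_one ?_ ht
  rw [neg_one_mul, ← sub_eq_add_neg, poch_one_sub_prime hp]

lemma poch_one_two_mul_eq (hp : p = 2 * n + 1) :
    poch (1 : ℚ_[p]) (2 * n) =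
      (-1) ^ n * 4 ^ n * poch (1 : ℚ_[p]) n * poch (1 - 1 / 2 * p : ℚ_[p]) n := by
  have reflect := poch_reflect (1 - 1 / 2 * p : ℚ_[p]) n
  rw [show (1 - n - (1 - 1 / 2 * p) : ℚ_[p]) = 1 / 2 by
    rw [natCast_eq_two_mul_add_one hp]; ring] at reflect
  rw [poch_double, reflect, one_add_one_eq_two, div_self two_ne_zero]
  ring

lemma poch_one_modEq_four_pow_mul (hp : p = 2 * n + 1) :
    PadicModEq p 2 (poch 1 n) (4 ^ n * poch (1 + 1 / 2 * p : ℚ_[p]) n) := by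
  have double := poch_double (1 + p : ℚ_[p]) n
  rw [show (1 + p : ℚ_[p]) / 2 = n + 1 by rw [natCast_eq_two_mul_add_one hp]; ring,
    show (1 + p + 1 : ℚ_[p]) / 2 = 1 + 1 / 2 * p by ring] at double
  have full := poch_one_add_mul_prime_modEq hp (one_mem _)
  rw [one_mul, double] at full
  have unit := norm_poch_one_eq_one (p := p) (k := 2 * n) (by omega)
  have ne := ne_zero_of_norm_eq_one unit
  have scaled := full.symm.const_mul (mul_mem (inv_mem_subring unit)
    (mem_subring_of_norm_eq_one (norm_poch_one_eq_one (p := p) (k := n) (by omega))))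
  convert scaled using 1
  · field_simp
  · rw [two_mul] at ne ⊢
    rw [← poch_natCast_succ_mul] at ne ⊢
    have := left_ne_zero_of_mul ne
    have := right_ne_zero_of_mul ne
    generalize poch (1 + 1 / 2 * p : ℚ_[p]) n = x
    field_simp

lemma hasUnitExpansion_poch_one_half (hp : p = 2 * n + 1) :
    HasUnitExpansion (fun t : ℚ_[p] => poch (1 + t * (1 / 2 * p)) n) (poch 1 n)
      (1 / 2 * pochLogDeriv 1 n) :=
  hasUnitExpansion_poch_one (by omega) (half_mem_subring hp)

lemma poch_one_sub_half_prime_div_modEq (hp : p = 2 * n + 1) :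
    PadicModEq p 2 (poch (1 - 1 / 2 * p : ℚ_[p]) n / poch (1 + 1 / 2 * p : ℚ_[p]) n)
      ((4 ^ n) ^ 2) := by
  have expansion := hasUnitExpansion_poch_one_half hp
  have product := expansion.mul_apply_neg_one
  have unit := expansion.norm_eq_one (one_mem _)
  rw [one_mul] at unit
  simp only [one_mul, neg_one_mul, ← sub_eq_add_neg] at product
  have ne := ne_zero_of_norm_eq_one unit
  have four := mem_subring_of_norm_eq_one (norm_four_pow_eq_one hp n)
  have square := (poch_one_modEq_four_pow_mul hp).pow
    (mul_mem four (mem_subring_of_norm_eq_one unit)) 2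
  have scaled := (product.trans square).const_mul (pow_mem (inv_mem_subring unit) 2)
  generalize poch (1 + 1 / 2 * p : ℚ_[p]) n = x, poch (1 - 1 / 2 * p : ℚ_[p]) n = y at scaled ne ⊢
  convert scaled using 1 <;> field_simp

theorem halfQuot_modEq (hp : p = 2 * n + 1) :
    PadicModEq p 2 (halfQuot p n) ((-1) ^ n * (4 ^ n) ^ 3) := by
  have h1 := poch_one_ne_zero (R := ℚ_[p]) n
  have sign : ((-1) ^ n * 4 ^ n : ℚ_[p]) ∈ PadicInt.subring p :=
    mul_mem (pow_mem (neg_mem (one_mem _)) n)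
      (mem_subring_of_norm_eq_one (norm_four_pow_eq_one hp n))
  convert (poch_one_sub_half_prime_div_modEq hp).const_mul sign using 1
  · rw [halfQuot, poch_one_two_mul_eq hp, mul_right_comm, mul_comm (poch 1 n),
      mul_div_mul_right _ _ h1, mul_div_assoc]
  · ring

end ClosedForms

section Dixon

lemma add_two_mul_mul_wellPoised_half {K : Type*} [Field K] [CharZero K] {a : K}
    (ha : ∀ i : ℕ, 1 + a / 2 + i ≠ 0) (k : ℕ) : (a + 2 * k) * wellPoised a (a / 2) k = a := by
  have shift := (poch_succ (a / 2) k).symm.trans (poch_succ_left _ _)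
  rw [add_comm (a / 2) 1] at shift
  rw [wellPoised, show 1 + a - a / 2 = 1 + a / 2 by ring, mul_div_assoc',
    div_eq_iff (poch_ne_zero ha k)]
  linear_combination 2 * shift

theorem sum_dixon {K : Type*} [Field K] [CharZero K] {a c : K} (ha : a ≠ 0)
    (hA : ∀ i : ℕ, 1 + a + i ≠ 0) (hb : ∀ i : ℕ, 1 + a / 2 + i ≠ 0)
    (hc : ∀ i : ℕ, 1 + a - c + i ≠ 0) (n : ℕ) :
    ∑ k ∈ Finset.range (n + 1), wellPoised a a k * wellPoised a (-n) k * wellPoised a c k =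
      poch (1 + a) n * poch (1 + a / 2 - c) n / (poch (1 + a / 2) n * poch (1 + a - c) n) := by
  have half : 1 + a - a / 2 = 1 + a / 2 := by ring
  have five := sum_wellPoised_five (b := a / 2) hA (by rwa [half]) hc n
  rw [half, mul_assoc, mul_div_assoc] at five
  refine mul_left_cancel₀ ha ?_
  rw [← five, Finset.mul_sum]
  refine Finset.sum_congr rfl fun k _ => ?_
  rw [veryWellPoised]
  linear_combination (-(wellPoised a a k * wellPoised a (-n) k * wellPoised a c k)) *
    add_two_mul_mul_wellPoised_half hb k

variable {p : ℕ} [Fact p.Prime] {m n : ℕ}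

/-- The value of Dixon's sum at `a = 1 / 2 + p / 3` and `c = 1 / 2 + p / 6`. -/
noncomputable def dixonQuot (p : ℕ) [Fact p.Prime] (n : ℕ) : ℚ_[p] :=
  poch (3 / 2 + 1 / 3 * p : ℚ_[p]) n * poch (3 / 4 : ℚ_[p]) n /
    (poch (5 / 4 + 1 / 6 * p : ℚ_[p]) n * poch (1 + 1 / 6 * p : ℚ_[p]) n)

lemma add_mul_natCast_add_ne_zero {x y : ℚ} (hx : 0 < x) (hy : 0 < y) (i : ℕ) :
    (x + y * p + i : ℚ_[p]) ≠ 0 := by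
  have : ((x + y * p + i : ℚ) : ℚ_[p]) ≠ 0 := Rat.cast_ne_zero.2 (by positivity)
  exact_mod_cast this

lemma sum_dixon_eq_dixonQuot (p : ℕ) [Fact p.Prime] (n : ℕ) :
    ∑ k ∈ Finset.range (n + 1), wellPoised (1 / 2 + 1 / 3 * p : ℚ_[p]) (1 / 2 + 1 / 3 * p) k *
      wellPoised (1 / 2 + 1 / 3 * p : ℚ_[p]) (-n) k *
      wellPoised (1 / 2 + 1 / 3 * p : ℚ_[p]) (1 / 2 + 1 / 6 * p) k = dixonQuot p n := by
  have pos := fun (x y : ℚ) => add_mul_natCast_add_ne_zero (p := p) (x := x) (y := y)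
  have lead := pos (1 / 2) (1 / 3) (by norm_num) (by norm_num) 0
  have lead_add := pos (3 / 2) (1 / 3) (by norm_num) (by norm_num)
  have half_add := pos (5 / 4) (1 / 6) (by norm_num) (by norm_num)
  have lower_add := pos 1 (1 / 6) (by norm_num) (by norm_num)
  push_cast at lead lead_add half_add lower_add
  have lead_eq : (1 + (1 / 2 + 1 / 3 * p) : ℚ_[p]) = 3 / 2 + 1 / 3 * p := by ring
  have half_eq : (1 + (1 / 2 + 1 / 3 * p) / 2 : ℚ_[p]) = 5 / 4 + 1 / 6 * p := by ring
  have lower_eq : (3 / 2 + 1 / 3 * p - (1 / 2 + 1 / 6 * p) : ℚ_[p]) = 1 + 1 / 6 * p := by ring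
  have upper_eq : (5 / 4 + 1 / 6 * p - (1 / 2 + 1 / 6 * p) : ℚ_[p]) = 3 / 4 := by ring
  have dixon := sum_dixon (a := (1 / 2 + 1 / 3 * p : ℚ_[p])) (c := 1 / 2 + 1 / 6 * p)
    (by simpa using lead) (by simpa only [lead_eq]) (by simpa only [half_eq])
    (by simpa only [lead_eq, lower_eq]) n
  rw [dixon, lead_eq, half_eq, lower_eq, upper_eq, dixonQuot]

lemma mem_subring_of_twelve_mul (hp3 : 3 < p) {x : ℚ_[p]} (z : ℤ) (hx : 12 * x = z) :
    x ∈ PadicInt.subring p := by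
  have two := norm_natCast_eq_one (p := p) (k := 2) (by norm_num) (by omega)
  have three := norm_natCast_eq_one (p := p) (k := 3) (by norm_num) hp3
  have twelve : ‖(12 : ℚ_[p])‖ = 1 := by
    rw [show (12 : ℚ_[p]) = (2 : ℕ) * (2 : ℕ) * (3 : ℕ) by norm_num]
    simp only [norm_mul, two, three, mul_one]
  rw [eq_div_of_mul_eq (ne_zero_of_norm_eq_one twelve) ((mul_comm _ _).trans hx)]
  exact div_mem_subring (intCast_mem _ z) twelve

/-- Both summands are products of rising factorials at arguments `1 / 2 + O(p)` over such at
`1 + O(p)`; they agree to first order because their upper parameters have the same sum, and so do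
their lower parameters. -/
lemma halfThreeFTwo_modEq (hp : p = 2 * n + 1) (hp3 : 3 < p) :
    PadicModEq p 2 (halfThreeFTwo p n) (dixonQuot p n) := by
  have half := half_mem_subring hp
  have third : (1 / 3 : ℚ_[p]) ∈ _ := mem_subring_of_twelve_mul hp3 4 (by norm_num)
  have sixth : (1 / 6 : ℚ_[p]) ∈ _ := mem_subring_of_twelve_mul hp3 2 (by norm_num)
  rw [← sum_dixon_eq_dixonQuot]
  refine PadicModEq.sum fun k hk => ?_
  have hk := Finset.mem_range_succ_iff.1 hk
  have unit : ∀ i < k, ‖(1 / 2 + i : ℚ_[p])‖ = 1 := fun i hi =>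
    norm_half_add_natCast_eq_one hp (hi.trans_le hk)
  have unit' : ∀ i < k, ‖(1 + 1 / 2 - 1 / 2 + i : ℚ_[p])‖ = 1 := fun i hi => by
    rw [add_sub_cancel_right]
    exact norm_one_add_natCast_eq_one (by omega)
  have upper := fun s : ℚ_[p] => hasUnitExpansion_poch (s := s) unit
  have lower := fun s : ℚ_[p] => hasUnitExpansion_poch_one (p := p) (s := s) (k := k) (by omega)
  have dixon := fun s : ℚ_[p] => hasUnitExpansion_wellPoised (s := s) unit unit' third
  have whipple := ((upper 0 (zero_mem _)).mul (upper _ (neg_mem half))).mul ((upper _ half).div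
    (((lower 0 (zero_mem _)).mul (lower _ half)).mul (lower _ half)))
  refine PadicModEq.trans (.of_eq ?_) ((whipple.congr (((dixon _ third).mul
    (dixon _ (neg_mem half))).mul (dixon _ sixth)) ?_ ?_).trans (.of_eq ?_))
  · rw [balancedCoeff, natCast_eq_two_mul_add_one hp]
    ring_nf
  · simp only [wellPoised, add_sub_cancel_right]
    ring
  · simp only [add_sub_cancel_right]
    ring
  · rw [natCast_eq_two_mul_add_one hp]
    ring_nf

lemma poch_three_quarters_eq (hp : p = 2 * (2 * m) + 1) (hp3 : 3 < p) :
    poch (3 / 4 : ℚ_[p]) (2 * m) = (-1) ^ m * poch (1 - 3 / 4 * p : ℚ_[p]) (2 * (2 * m)) /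
      (poch (1 - 1 / 4 * p : ℚ_[p]) m * poch (1 - 3 / 4 * p : ℚ_[p]) m) := by
  have unit := fun (x : ℚ_[p]) (z : ℤ) (hx : 12 * x = z) => norm_poch_one_sub_mul_prime_eq_one
    (k := m) (by omega) (mem_subring_of_twelve_mul hp3 z hx)
  have quarter := ne_zero_of_norm_eq_one (unit (1 / 4) 3 (by norm_num))
  have three_quarters := ne_zero_of_norm_eq_one (unit (3 / 4) 9 (by norm_num))
  have prime_eq := natCast_eq_two_mul_add_one hp
  push_cast at prime_eq
  have sign : ((-1 : ℚ_[p]) ^ m) * (-1) ^ m = 1 := by rw [← mul_pow]; simp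
  have middle := poch_reflect (3 / 4 : ℚ_[p]) (2 * m)
  rw [pow_mul, neg_one_sq, one_pow, one_mul,
    show (1 - (2 * m : ℕ) - 3 / 4 : ℚ_[p]) = 1 - 3 / 4 * p + m by
      rw [prime_eq]; push_cast; ring] at middle
  have last := poch_reflect (1 - 1 / 4 * p : ℚ_[p]) m
  rw [show (1 - m - (1 - 1 / 4 * p) : ℚ_[p]) = 1 - 3 / 4 * p + (m + 2 * m : ℕ) by
    rw [prime_eq]; push_cast; ring] at last
  rw [show 2 * (2 * m) = m + 2 * m + m by ring, poch_add, poch_add, middle, last,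
    eq_div_iff (mul_ne_zero quarter three_quarters)]
  linear_combination (-(poch (3 / 4 : ℚ_[p]) (2 * m) * poch (1 - 1 / 4 * p : ℚ_[p]) m *
    poch (1 - 3 / 4 * p : ℚ_[p]) m)) * sign

lemma four_pow_mul_poch_mul_poch (hp : p = 2 * (2 * m) + 1) :
    4 ^ m * poch (3 / 4 + 1 / 6 * p : ℚ_[p]) m * poch (1 - 5 / 12 * p : ℚ_[p]) m =
      (-1) ^ m * poch (1 - 5 / 6 * p : ℚ_[p]) (2 * m) := by
  have prime_eq := natCast_eq_two_mul_add_one hp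
  push_cast at prime_eq
  have reflect := poch_reflect (1 / 2 - 5 / 12 * p : ℚ_[p]) m
  rw [show (1 - m - (1 / 2 - 5 / 12 * p) : ℚ_[p]) = 3 / 4 + 1 / 6 * p by
    rw [prime_eq]; ring] at reflect
  have double := poch_double (1 - 5 / 6 * p : ℚ_[p]) m
  rw [show ((1 - 5 / 6 * p) / 2 : ℚ_[p]) = 1 / 2 - 5 / 12 * p by ring,
    show ((1 - 5 / 6 * p + 1) / 2 : ℚ_[p]) = 1 - 5 / 12 * p by ring] at double
  rw [double, reflect]
  ring

lemma poch_three_halves_div_eq (hp : p = 2 * (2 * m) + 1) (hp3 : 3 < p) :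
    poch (3 / 2 + 1 / 3 * p : ℚ_[p]) (2 * m) / poch (5 / 4 + 1 / 6 * p : ℚ_[p]) (2 * m) =
      (-1) ^ m * poch (1 - 5 / 6 * p : ℚ_[p]) (2 * m) /
        (poch (1 - 5 / 12 * p : ℚ_[p]) m * poch (1 + 5 / 12 * p : ℚ_[p]) m) := by
  have prime_eq := natCast_eq_two_mul_add_one hp
  push_cast at prime_eq
  have five_twelfths := mem_subring_of_twelve_mul (x := (5 / 12 : ℚ_[p])) hp3 5 (by norm_num)
  have minus := ne_zero_of_norm_eq_one
    (norm_poch_one_sub_mul_prime_eq_one (k := m) (by omega) five_twelfths)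
  have cancel : poch (5 / 4 + 1 / 6 * p : ℚ_[p]) m ≠ 0 := poch_ne_zero (fun i => by
    simpa using add_mul_natCast_add_ne_zero (p := p) (x := 5 / 4) (y := 1 / 6) (by norm_num)
      (by norm_num) i) m
  have upper := poch_double (3 / 2 + 1 / 3 * p : ℚ_[p]) m
  rw [show ((3 / 2 + 1 / 3 * p) / 2 : ℚ_[p]) = 3 / 4 + 1 / 6 * p by ring,
    show ((3 / 2 + 1 / 3 * p + 1) / 2 : ℚ_[p]) = 5 / 4 + 1 / 6 * p by ring, ← mul_assoc] at upper
  have lower := poch_add (5 / 4 + 1 / 6 * p : ℚ_[p]) m m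
  rw [← two_mul, show (5 / 4 + 1 / 6 * p + m : ℚ_[p]) = 1 + 5 / 12 * p by
    rw [prime_eq]; ring] at lower
  rw [upper, lower, mul_comm (poch (5 / 4 + 1 / 6 * p : ℚ_[p]) m) (poch (1 + 5 / 12 * p : ℚ_[p]) m),
    mul_div_mul_right _ _ cancel, ← four_pow_mul_poch_mul_poch hp,
    mul_comm (poch (1 - 5 / 12 * p : ℚ_[p]) m), mul_div_mul_right _ _ minus]

lemma dixonQuot_eq (hp : p = 2 * (2 * m) + 1) (hp3 : 3 < p) :
    dixonQuot p (2 * m) =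
      poch (1 - 5 / 6 * p : ℚ_[p]) (2 * m) / poch (1 + 1 / 6 * p : ℚ_[p]) (2 * m) *
        (poch (1 - 3 / 4 * p : ℚ_[p]) (2 * (2 * m)) /
          (poch (1 - 5 / 12 * p : ℚ_[p]) m * poch (1 + 5 / 12 * p : ℚ_[p]) m *
            (poch (1 - 1 / 4 * p : ℚ_[p]) m * poch (1 - 3 / 4 * p : ℚ_[p]) m))) := by
  have sign : ((-1 : ℚ_[p]) ^ m) * (-1) ^ m = 1 := by rw [← mul_pow]; simp
  rw [dixonQuot, mul_div_mul_comm, poch_three_halves_div_eq hp hp3, poch_three_quarters_eq hp hp3,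
    div_div, div_mul_div_comm, mul_mul_mul_comm, sign, one_mul, div_mul_div_comm]
  congr 1
  ring

lemma exists_mem_subring_poch_eq {x z : ℚ_[p]} {i k : ℕ} (hx : x ∈ PadicInt.subring p)
    (hz : z ∈ PadicInt.subring p) (hi : i < k) (h : x + i = p * z) :
    ∃ w ∈ PadicInt.subring p, poch x k = p * w := by
  obtain ⟨j, rfl⟩ := Nat.exists_eq_add_of_lt hi
  refine ⟨poch x i * z * poch (x + (i + 1 : ℕ)) j, mul_mem (mul_mem (poch_mem_subring hx i) hz)
    (poch_mem_subring (add_mem hx (natCast_padic_mem_subring _)) j), ?_⟩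
  rw [add_right_comm, poch_add, poch_succ, h]
  ring

lemma dixonQuot_modEq_zero (hp : p = 4 * m + 3) (hp3 : 3 < p) :
    PadicModEq p 2 (dixonQuot p (2 * m + 1)) 0 := by
  have hP : (p : ℚ_[p]) = 4 * m + 3 := by
    exact_mod_cast congrArg (Nat.cast (R := ℚ_[p])) hp
  have mem := fun x : ℚ_[p] => mem_subring_of_twelve_mul (x := x) hp3
  have sixth : (1 / 6 : ℚ_[p]) ∈ _ := mem _ 2 (by norm_num)
  have upper_mem : (3 / 2 + 1 / 3 * p : ℚ_[p]) ∈ _ := mem _ (18 + 4 * p) (by push_cast; ring)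
  obtain ⟨v, hv, first⟩ := exists_mem_subring_poch_eq (k := 2 * m + 1) upper_mem
    (mem (5 / 6) 10 (by norm_num)) (2 * m).lt_succ_self (by rw [hP]; push_cast; ring)
  obtain ⟨w, hw, second⟩ := exists_mem_subring_poch_eq (p := p) (x := 3 / 4) (k := 2 * m + 1)
    (mem _ 9 (by norm_num)) (mem (1 / 4) 3 (by norm_num)) (by omega : m < _) (by rw [hP]; ring)
  have unit : ∀ i < 2 * m + 1, ‖(5 / 4 + i : ℚ_[p])‖ = 1 := fun i hi => by
    have four := norm_natCast_eq_one (p := p) (k := 4) (by norm_num) (by omega)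
    refine mod_cast norm_div_add_natCast_eq_one (u := 5) four
      ((Nat.Prime.coprime_iff_not_dvd Fact.out).2 fun (dvd : p ∣ 5 + 4 * i) => ?_)
    have := Nat.eq_of_dvd_of_lt_two_mul (by omega) dvd (by omega)
    omega
  have lower := (hasUnitExpansion_poch unit sixth).norm_eq_one (one_mem _)
  have lower' := norm_poch_one_add_mul_prime_eq_one (p := p) (k := 2 * m + 1) (by omega) sixth
  rw [one_mul] at lower
  refine PadicModEq.iff_exists_mem_subring.2 ⟨_, div_mem_subring (mul_mem hv hw)
    (show ‖poch (5 / 4 + 1 / 6 * p : ℚ_[p]) (2 * m + 1) * poch (1 + 1 / 6 * p : ℚ_[p]) (2 * m + 1)‖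
      = 1 by rw [norm_mul, lower, lower', one_mul]), ?_⟩
  rw [dixonQuot, first, second]
  ring

lemma poch_one_sub_div_poch_one_add_modEq (hp : p = 2 * n + 1) (hp3 : 3 < p) :
    PadicModEq p 2 (poch (1 - 5 / 6 * p : ℚ_[p]) n / poch (1 + 1 / 6 * p : ℚ_[p]) n)
      ((4 ^ n) ^ 2) := by
  have mem := fun x : ℚ_[p] => mem_subring_of_twelve_mul (x := x) hp3
  have half := half_mem_subring hp
  have expansion := fun (s : ℚ_[p]) => hasUnitExpansion_poch_one (s := s) (k := n) (by omega)
  have quotient := (expansion _ (neg_mem (mem (5 / 6) 10 (by norm_num)))).div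
    (expansion _ (mem (1 / 6) 2 (by norm_num)))
  have agree := quotient.congr ((expansion _ (neg_mem half)).div (expansion _ half)) rfl (by ring)
  simp only [one_mul, neg_mul, ← sub_eq_add_neg] at agree
  exact agree.trans (poch_one_sub_half_prime_div_modEq hp)

lemma poch_product_modEq_pow_four {k : ℕ} (hk : k < p) (hp3 : 3 < p) :
    PadicModEq p 2
      (poch (1 - 5 / 12 * p : ℚ_[p]) k * poch (1 + 5 / 12 * p : ℚ_[p]) k *
        (poch (1 - 1 / 4 * p : ℚ_[p]) k * poch (1 - 3 / 4 * p : ℚ_[p]) k))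
      (poch (1 - 1 / 4 * p : ℚ_[p]) k ^ 4) := by
  have mem := fun x : ℚ_[p] => mem_subring_of_twelve_mul (x := x) hp3
  have five_twelfths := mem (5 / 12) 5 (by norm_num)
  have expansion := fun (s : ℚ_[p]) => hasUnitExpansion_poch_one (s := s) hk
  have quarter := expansion _ (neg_mem (mem (1 / 4) 3 (by norm_num)))
  have three_quarters := expansion _ (neg_mem (mem (3 / 4) 9 (by norm_num)))
  have product := ((expansion _ (neg_mem five_twelfths)).mul (expansion _ five_twelfths)).mul
    (quarter.mul three_quarters)
  have agree := product.congr (quarter.pow 4) (by ring) (by push_cast; ring)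
  simpa only [one_mul, neg_mul, ← sub_eq_add_neg] using agree

theorem dixonQuot_modEq (hp : p = 2 * (2 * m) + 1) (hp3 : 3 < p) :
    PadicModEq p 2 (dixonQuot p (2 * m))
      ((4 ^ (2 * m)) ^ 2 * (poch 1 (2 * (2 * m)) / poch (1 - 1 / 4 * p : ℚ_[p]) m ^ 4)) := by
  have mem := fun x : ℚ_[p] => mem_subring_of_twelve_mul (x := x) hp3
  have full := poch_one_add_mul_prime_modEq hp (neg_mem (mem (3 / 4) 9 (by norm_num)))
  rw [neg_mul, ← sub_eq_add_neg] at full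
  have full_mem := mem_subring_of_norm_eq_one
    (norm_poch_one_eq_one (p := p) (k := 2 * (2 * m)) (by omega))
  have denominators := poch_product_modEq_pow_four (p := p) (k := m) (by omega) hp3
  have unit : ‖poch (1 - 1 / 4 * p : ℚ_[p]) m ^ 4‖ = 1 := by
    rw [norm_pow, norm_poch_one_sub_mul_prime_eq_one (by omega) (mem (1 / 4) 3 (by norm_num)),
      one_pow]
  rw [dixonQuot_eq hp hp3]
  exact (poch_one_sub_div_poch_one_add_modEq hp hp3).mul
    (full.div denominators full_mem (denominators.norm_eq_one two_ne_zero unit) unit)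
    (pow_mem (mem_subring_of_norm_eq_one (norm_four_pow_eq_one hp _)) 2)
    (div_mem_subring full_mem unit)

end Dixon

section Wilson

variable {R : Type*} [CommRing R]

lemma eq_one_or_eq_neg_one_of_sq_eq_one [IsLocalRing R] (h2 : IsUnit (2 : R)) {u : R}
    (hu : u ^ 2 = 1) : u = 1 ∨ u = -1 := by
  have product : (u - 1) * (u + 1) = 0 := by linear_combination hu
  have sum : IsUnit ((u + 1) + (1 - u)) := by convert h2 using 1; ring
  rcases IsLocalRing.isUnit_or_isUnit_of_isUnit_add sum with plus | minus
  · exact .inl (sub_eq_zero.1 ((plus.mul_left_eq_zero).1 product))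
  · rw [← neg_sub 1 u, neg_mul, neg_eq_zero, minus.mul_right_eq_zero] at product
    exact .inr (eq_neg_of_add_eq_zero_left product)

/-- Pairing each unit with its inverse leaves only `1` and `-1`. -/
theorem prod_units_eq_neg_one [IsLocalRing R] [Fintype Rˣ] (h2 : IsUnit (2 : R)) :
    ∏ u : Rˣ, u = -1 := by
  classical
  have others : ∏ u ∈ (Finset.univ.erase (-1) : Finset Rˣ), u = 1 := by
    refine Finset.prod_involution (fun u _ => u⁻¹) (by simp) (fun u hu hne hinv => ?_)
      (fun u hu => ?_) (by simp)
    · have square : (u : R) ^ 2 = 1 := by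
        rw [← Units.val_pow_eq_pow_val, sq, inv_eq_iff_mul_eq_one.1 hinv, Units.val_one]
      rcases eq_one_or_eq_neg_one_of_sq_eq_one h2 square with one | neg_one
      · exact hne (Units.ext one)
      · exact Finset.ne_of_mem_erase hu (Units.ext (by simpa using neg_one))
    · simpa [inv_eq_iff_eq_inv] using hu
  rw [← Finset.mul_prod_erase Finset.univ _ (Finset.mem_univ (-1)), others, mul_one]

lemma prod_range_filter_coprime_eq_prod_units (n : ℕ) [NeZero n] :
    ∏ j ∈ (Finset.range n).filter (Nat.Coprime · n), (j : ZMod n) =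
      ((∏ u : (ZMod n)ˣ, u : (ZMod n)ˣ) : ZMod n) := by
  rw [Units.coe_prod]
  symm
  refine Finset.prod_bij (fun u _ => (u : ZMod n).val) (fun u _ => ?_)
    (fun u _ v _ huv => Units.ext (ZMod.val_injective _ huv)) (fun j hj => ?_) (by simp)
  · simpa using ⟨ZMod.val_lt _, ZMod.val_coe_unit_coprime u⟩
  · rw [Finset.mem_filter, Finset.mem_range] at hj
    exact ⟨ZMod.unitOfCoprime j hj.2, Finset.mem_univ _, by
      rw [ZMod.coe_unitOfCoprime, ZMod.val_natCast, Nat.mod_eq_of_lt hj.1]⟩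

end Wilson

section MoritaSequence

variable {p : ℕ} [Fact p.Prime] {k : ℕ}

lemma prod_range_prime_pow_filter_coprime (hp2 : p ≠ 2) (hk : k ≠ 0) :
    ∏ j ∈ (Finset.range (p ^ k)).filter (Nat.Coprime · p), (j : ZMod (p ^ k)) = -1 := by
  have prime : p.Prime := Fact.out
  have : Fact (1 < p ^ k) := ⟨Nat.one_lt_pow hk prime.one_lt⟩
  have : IsLocalRing (ZMod (p ^ k)) :=
    .of_surjective' (PadicInt.toZModPow (p := p) k) (ZMod.ringHom_surjective _)
  have two : IsUnit (2 : ZMod (p ^ k)) := mod_cast (ZMod.isUnit_iff_coprime 2 (p ^ k)).2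
    (((Nat.coprime_primes Nat.prime_two prime).2 hp2.symm).pow_right k)
  simp_rw [← Nat.coprime_pow_right_iff (Nat.pos_of_ne_zero hk) _ p]
  rw [prod_range_filter_coprime_eq_prod_units, prod_units_eq_neg_one two, Units.val_neg,
    Units.val_one]

lemma moritaSeq_add (a b : ℕ) :
    moritaSeq p (a + b) = moritaSeq p a *
      ∏ i ∈ Finset.range b, -(if (a + i).Coprime p then ((a + i : ℕ) : ℤ_[p]) else 1) := by
  simp only [moritaSeq, Finset.prod_filter, Finset.prod_range_add, pow_add, Finset.prod_neg,
    Finset.card_range]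
  ring

lemma periodic_toZModPow_moritaSeq (hp2 : p ≠ 2) (k : ℕ) :
    Function.Periodic (fun n => PadicInt.toZModPow k (moritaSeq p n)) (p ^ k) := by
  intro n
  rcases eq_or_ne k 0 with rfl | hk
  · exact Subsingleton.elim (α := ZMod 1) _ _
  have period : PadicInt.toZModPow k (moritaSeq p (p ^ k)) = 1 := by
    have odd : Odd (p ^ k) := ((Fact.out : p.Prime).odd_of_ne_two hp2).pow
    simp [moritaSeq, odd.neg_one_pow, prod_range_prime_pow_filter_coprime hp2 hk]
  have coprime (i : ℕ) : (p ^ k + i).Coprime p ↔ (0 + i).Coprime p := by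
    rw [← Nat.succ_pred_eq_of_ne_zero hk, pow_succ, Nat.coprime_mul_right_add_left, zero_add]
  have vanish : (p : ZMod (p ^ k)) ^ k = 0 := mod_cast ZMod.natCast_self (p ^ k)
  have zero : moritaSeq p 0 = 1 := by simp [moritaSeq]
  simp only [add_comm n]
  rw [← zero_add n, moritaSeq_add, moritaSeq_add, map_mul, map_mul, period, zero, map_one,
    map_prod, map_prod, zero_add n]
  simp only [coprime]
  refine congrArg _ (Finset.prod_congr rfl fun i _ => ?_)
  split_ifs <;> simp [vanish]

lemma toZModPow_moritaSeq_eq (hp2 : p ≠ 2) {a b : ℕ} (hab : (a : ZMod (p ^ k)) = b) :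
    PadicInt.toZModPow k (moritaSeq p a) = PadicInt.toZModPow k (moritaSeq p b) := by
  have periodic := (periodic_toZModPow_moritaSeq hp2 k).map_mod_nat
  have mod : a % p ^ k = b % p ^ k := (ZMod.natCast_eq_natCast_iff _ _ _).1 hab
  exact (periodic a).symm.trans (mod ▸ periodic b)

end MoritaSequence

section PadicGamma

variable {p : ℕ} [Fact p.Prime] {k : ℕ} {x y : ℤ_[p]}

lemma mem_closedBall_iff_toZModPow_eq :
    y ∈ Metric.closedBall x ((p : ℝ) ^ (-k : ℤ)) ↔
      PadicInt.toZModPow k y = PadicInt.toZModPow k x := by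
  rw [Metric.mem_closedBall, dist_eq_norm, PadicInt.norm_le_pow_iff_mem_span_pow,
    ← PadicInt.ker_toZModPow, RingHom.sub_mem_ker_iff]

lemma padicModEq_coe_iff :
    PadicModEq p k (x : ℚ_[p]) y ↔ PadicInt.toZModPow k x = PadicInt.toZModPow k y := by
  rw [← RingHom.sub_mem_ker_iff, PadicInt.ker_toZModPow, Ideal.mem_span_singleton]
  exact exists_congr fun z =>
    ⟨fun h => PadicInt.ext (mod_cast h), fun h => by rw [← PadicInt.coe_sub, h]; push_cast; rfl⟩

lemma eventually_natCast_eq_toZModPow (k : ℕ) (x : ℤ_[p]) :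
    ∀ᶠ n : ℕ in comap (Nat.cast : ℕ → ℤ_[p]) (𝓝 x),
      (n : ZMod (p ^ k)) = PadicInt.toZModPow k x := by
  have radius : (0 : ℝ) < (p : ℝ) ^ (-k : ℤ) :=
    zpow_pos (Nat.cast_pos.2 (Fact.out : p.Prime).pos) _
  filter_upwards [preimage_mem_comap (Metric.closedBall_mem_nhds x radius)] with n hn
  rw [← mem_closedBall_iff_toZModPow_eq.1 hn, map_natCast]

instance neBot_comap_natCast_nhds (x : ℤ_[p]) : NeBot (comap (Nat.cast : ℕ → ℤ_[p]) (𝓝 x)) :=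
  comap_neBot fun _ ht => PadicInt.denseRange_natCast.mem_nhds ht

theorem tendsto_moritaSeq (hp2 : p ≠ 2) (x : ℤ_[p]) :
    Tendsto (moritaSeq p) (comap (Nat.cast : ℕ → ℤ_[p]) (𝓝 x)) (𝓝 (padicGamma p x)) := by
  refine tendsto_nhds_limUnder (cauchy_map_iff_exists_tendsto.1 ?_)
  refine Metric.cauchy_iff.2 ⟨inferInstance, fun ε hε => ?_⟩
  obtain ⟨k, hk⟩ := PadicInt.exists_pow_neg_lt p hε
  refine ⟨_, image_mem_map (eventually_natCast_eq_toZModPow k x), ?_⟩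
  rintro _ ⟨a, ha, rfl⟩ _ ⟨b, hb, rfl⟩
  exact (mem_closedBall_iff_toZModPow_eq.2
    (toZModPow_moritaSeq_eq hp2 (ha.trans hb.symm))).trans_lt hk

theorem padicGamma_modEq_moritaSeq (hp2 : p ≠ 2) {a : ℕ} (ha : PadicModEq p k a x) :
    PadicModEq p k (padicGamma p x) (moritaSeq p a) := by
  rw [← PadicInt.coe_natCast, padicModEq_coe_iff, map_natCast] at ha
  rw [padicModEq_coe_iff, ← mem_closedBall_iff_toZModPow_eq]
  refine Metric.isClosed_closedBall.mem_of_tendsto (tendsto_moritaSeq hp2 x) ?_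
  filter_upwards [eventually_natCast_eq_toZModPow k x] with n hn
  exact mem_closedBall_iff_toZModPow_eq.2 (toZModPow_moritaSeq_eq hp2 (hn.trans ha.symm))

end PadicGamma

section GammaQuarter

variable {p : ℕ} [Fact p.Prime] {m n : ℕ}

lemma poch_modEq {x y : ℚ_[p]} (h : PadicModEq p n x y) (hy : y ∈ PadicInt.subring p) (k : ℕ) :
    PadicModEq p n (poch x k) (poch y k) := by
  induction k with
  | zero => simp [PadicModEq.refl]
  | succ k ih =>
    rw [poch_succ, poch_succ]
    exact ih.mul (h.add (.refl _)) (poch_mem_subring hy k)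
      (add_mem hy (natCast_padic_mem_subring k))

lemma moritaSeq_mul_prime_add_succ {s : ℕ} (hs : s < p) (M : ℕ) :
    (moritaSeq p (M * p + (s + 1)) : ℚ_[p]) =
      moritaSeq p (M * p) * ((-1) ^ (s + 1) * poch (1 + M * p : ℚ_[p]) s) := by
  have prime : p.Prime := Fact.out
  have coprime : ∀ i < s, (M * p + (i + 1)).Coprime p := fun i hi => by
    rw [Nat.coprime_mul_right_add_left]
    exact (Nat.coprime_of_lt_prime i.succ_ne_zero (by omega) prime).symm
  rw [moritaSeq_add, PadicInt.coe_mul, Finset.prod_neg, Finset.card_range, Finset.prod_range_succ',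
    if_neg (by simpa using prime.ne_one), mul_one, poch_eq_prod,
    Finset.prod_congr rfl fun i hi => if_pos (coprime i (Finset.mem_range.1 hi))]
  push_cast
  congr 2
  refine (map_prod PadicInt.Coe.ringHom _ _).trans (Finset.prod_congr rfl fun i _ => ?_)
  exact (by push_cast; ring :
    ((M * p + (i + 1) : ℤ_[p]) : ℚ_[p]) = 1 + M * p + i)

lemma moritaSeq_mul_prime_modEq (hp : p = 2 * n + 1) (M : ℕ) :
    PadicModEq p 2 (moritaSeq p (M * p)) (((-1) ^ p * poch 1 (2 * n)) ^ M) := by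
  have unit := mem_subring_of_norm_eq_one
    (norm_poch_one_eq_one (p := p) (k := 2 * n) (by omega))
  have sign : ((-1 : ℚ_[p]) ^ p) ∈ _ := pow_mem (neg_mem (one_mem (PadicInt.subring p))) p
  induction M with
  | zero => simp [moritaSeq, PadicModEq.refl]
  | succ M ih =>
    have block := moritaSeq_mul_prime_add_succ (p := p) (s := 2 * n) (by omega) M
    rw [← hp] at block
    rw [add_one_mul, block, pow_succ]
    exact ih.mul ((poch_one_add_mul_prime_modEq hp (natCast_padic_mem_subring M)).const_mul sign)
      (pow_mem (mul_mem sign unit) M) (mul_mem sign unit)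

lemma poch_one_pow_prime_modEq (hp : p = 2 * n + 1) :
    PadicModEq p 2 (poch (1 : ℚ_[p]) (2 * n) ^ p) (-1) := by
  have wilson : (p : ℤ) ∣ ((2 * n).factorial : ℤ) - (-1) := by
    have := ZMod.wilsons_lemma p
    rw [show p - 1 = 2 * n by omega] at this
    rw [← ZMod.intCast_zmod_eq_zero_iff_dvd]
    push_cast
    rw [this, sub_self]
  have lifted := dvd_sub_pow_of_dvd_sub wilson 1
  rw [pow_one, Odd.neg_one_pow ⟨n, hp⟩] at lifted
  obtain ⟨c, hc⟩ := lifted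
  exact ⟨c, by simpa [poch_one] using congrArg (Int.cast : ℤ → ℚ_[p]) hc⟩

lemma padicInt_inv_four_eq (hp : p = 2 * n + 1) : (PadicInt.inv (4 : ℤ_[p]) : ℚ_[p]) = 1 / 4 := by
  have unit : ‖(4 : ℤ_[p])‖ = 1 := by
    have four := norm_four_pow_eq_one hp 1
    rw [pow_one] at four
    exact four
  rw [eq_div_iff (by norm_num), mul_comm]
  exact_mod_cast congrArg Subtype.val (PadicInt.mul_inv unit)

lemma poch_one_add_three_mul_prime_modEq (hp : p = 2 * (2 * m) + 1) (hp3 : 3 < p) :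
    PadicModEq p 2 (poch (1 + (3 * m : ℕ) * p : ℚ_[p]) (3 * m))
      ((-1) ^ m * (poch 1 (2 * (2 * m)) / poch (1 - 1 / 4 * p : ℚ_[p]) m)) := by
  have mem := fun x : ℚ_[p] => mem_subring_of_twelve_mul (x := x) hp3
  have three_quarters := mem (3 / 4) 9 (by norm_num)
  have prime_eq := natCast_eq_two_mul_add_one hp
  push_cast at prime_eq
  have unit := norm_poch_one_sub_mul_prime_eq_one (p := p) (k := m) (by omega)
    (mem (1 / 4) 3 (by norm_num))
  have argument : PadicModEq p 2 (1 + (3 * m : ℕ) * p : ℚ_[p]) (1 + -(3 / 4) * p) :=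
    PadicModEq.iff_exists_mem_subring.2 ⟨3 / 4, three_quarters, by
      push_cast; linear_combination (-(3 / 4) * p : ℚ_[p]) * prime_eq⟩
  have reflect := poch_reflect (1 - 1 / 4 * p : ℚ_[p]) m
  rw [show (1 - m - (1 - 1 / 4 * p) : ℚ_[p]) = 1 + -(3 / 4) * p + (3 * m : ℕ) by
    rw [prime_eq]; push_cast; ring] at reflect
  have split : poch (1 + -(3 / 4) * p : ℚ_[p]) (3 * m) =
      (-1) ^ m / poch (1 - 1 / 4 * p : ℚ_[p]) m *
        poch (1 + -(3 / 4) * p : ℚ_[p]) (2 * (2 * m)) := by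
    rw [show 2 * (2 * m) = 3 * m + m by ring, poch_add, reflect]
    have := ne_zero_of_norm_eq_one unit
    have sign : ((-1 : ℚ_[p]) ^ m) ^ 2 = 1 := by rw [← pow_mul, mul_comm, pow_mul]; norm_num
    generalize poch (1 - 1 / 4 * p : ℚ_[p]) m = P at *
    field_simp
    rw [sign, mul_one]
  refine (poch_modEq argument (mem _ (12 - 9 * p) (by push_cast; ring)) _).trans ?_
  rw [split, mul_div_assoc', ← div_mul_eq_mul_div]
  exact (poch_one_add_mul_prime_modEq hp (neg_mem three_quarters)).const_mul
    (div_mem_subring (pow_mem (neg_mem (one_mem _)) m) unit)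

/-- The natural number `3 m p + (3 m + 1)` agrees with `1 / 4` modulo `p ^ 2`. -/
lemma padicGamma_inv_four_modEq (hp : p = 2 * (2 * m) + 1) (hp3 : 3 < p) :
    PadicModEq p 2 (padicGamma p (PadicInt.inv 4))
      ((-1) ^ (m + 1) * (poch 1 (2 * (2 * m)) ^ (3 * m + 1) /
        poch (1 - 1 / 4 * p : ℚ_[p]) m)) := by
  have mem := fun x : ℚ_[p] => mem_subring_of_twelve_mul (x := x) hp3
  have prime_eq := natCast_eq_two_mul_add_one hp
  push_cast at prime_eq
  have argument : PadicModEq p 2 ((3 * m * p + (3 * m + 1) : ℕ) : ℚ_[p])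
      (PadicInt.inv (4 : ℤ_[p])) := by
    rw [padicInt_inv_four_eq hp]
    refine PadicModEq.iff_exists_mem_subring.2 ⟨3 / 4, mem _ 9 (by norm_num), ?_⟩
    push_cast
    linear_combination (-(3 / 4) * (p + 1) : ℚ_[p]) * prime_eq
  have sign : ∀ k : ℕ, ((-1 : ℚ_[p]) ^ k) ∈ PadicInt.subring p :=
    pow_mem (neg_mem (one_mem _))
  have full := mem_subring_of_norm_eq_one
    (norm_poch_one_eq_one (p := p) (k := 2 * (2 * m)) (by omega))
  have unit := norm_poch_one_sub_mul_prime_eq_one (p := p) (k := m) (by omega)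
    (mem (1 / 4) 3 (by norm_num))
  refine (padicGamma_modEq_moritaSeq (by omega) argument).trans ?_
  rw [moritaSeq_mul_prime_add_succ (by omega)]
  refine ((moritaSeq_mul_prime_modEq hp (3 * m)).mul
    ((poch_one_add_three_mul_prime_modEq hp hp3).const_mul (sign _))
    (pow_mem (mul_mem (sign _) full) _)
    (mul_mem (sign _) (mul_mem (sign _) (div_mem_subring full unit)))).trans (.of_eq ?_)
  rw [Odd.neg_one_pow ⟨2 * m, hp⟩, pow_succ (poch (1 : ℚ_[p]) _)]
  have cube : (-1 : ℚ_[p]) ^ (3 * m) = (-1) ^ m := by rw [pow_mul]; norm_num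
  have square : (-1 : ℚ_[p]) ^ m * (-1) ^ m = 1 := by rw [← mul_pow]; simp
  rw [mul_pow, pow_succ (-1), pow_succ (-1), cube]
  linear_combination (-(-1) ^ m * (poch (1 : ℚ_[p]) (2 * (2 * m)) ^ (3 * m) *
    poch 1 (2 * (2 * m)) / poch (1 - 1 / 4 * p : ℚ_[p]) m)) * square

/-- `w = (p - 1)!` enters to the power `4 (3 m + 1) = 3 p + 1`, and `w ^ p ≡ -1` modulo `p ^ 2`. -/
theorem padicGamma_inv_four_pow_modEq (hp : p = 2 * (2 * m) + 1) (hp3 : 3 < p) :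
    PadicModEq p 2 ((padicGamma p (PadicInt.inv 4) : ℚ_[p]) ^ 4)
      (-(poch 1 (2 * (2 * m)) / poch (1 - 1 / 4 * p : ℚ_[p]) m ^ 4)) := by
  have full := mem_subring_of_norm_eq_one
    (norm_poch_one_eq_one (p := p) (k := 2 * (2 * m)) (by omega))
  have unit := norm_poch_one_sub_mul_prime_eq_one (p := p) (k := m) (by omega)
    (mem_subring_of_twelve_mul (x := (1 / 4 : ℚ_[p])) hp3 3 (by norm_num))
  have sign : ((-1 : ℚ_[p]) ^ (m + 1)) ∈ PadicInt.subring p := pow_mem (neg_mem (one_mem _)) _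
  have unit' : ‖poch (1 - 1 / 4 * p : ℚ_[p]) m ^ 4‖ = 1 := by rw [norm_pow, unit, one_pow]
  have fourth := (padicGamma_inv_four_modEq hp hp3).pow
    (mul_mem sign (div_mem_subring (pow_mem full _) unit)) 4
  have wilson := ((poch_one_pow_prime_modEq hp).pow (neg_mem (one_mem _)) 3).const_mul
    (div_mem_subring full unit')
  refine (fourth.trans (.of_eq ?_)).trans (wilson.trans (.of_eq (by ring)))
  have positive : ((-1 : ℚ_[p]) ^ (m + 1)) ^ 4 = 1 := by rw [← pow_mul, mul_comm, pow_mul]; norm_num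
  rw [mul_pow, positive, div_pow, ← pow_mul, show (3 * m + 1) * 4 = p * 3 + 1 by omega,
    pow_succ (poch _ _), pow_mul]
  ring

end GammaQuarter

section FermatQuotient

variable {p : ℕ} [Fact p.Prime] {n a : ℕ}

lemma exists_intCast_eq_fermatQuotient (ha : a.Coprime p) : ∃ c : ℤ, fermatQuotient p a = c := by
  have fermat : (a : ℤ) ^ (p - 1) ≡ 1 [ZMOD p] :=
    Int.ModEq.pow_card_sub_one_eq_one Fact.out (Nat.isCoprime_iff_coprime.2 ha)
  obtain ⟨c, hc⟩ := fermat.symm.dvd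
  refine ⟨c, ?_⟩
  rw [fermatQuotient, div_eq_iff (Nat.cast_ne_zero.2 (Fact.out : p.Prime).ne_zero), mul_comm]
  exact_mod_cast hc

lemma pow_prime_sub_one_eq : (a : ℚ) ^ (p - 1) = 1 + p * fermatQuotient p a := by
  rw [fermatQuotient, mul_div_cancel₀ _ (Nat.cast_ne_zero.2 (Fact.out : p.Prime).ne_zero),
    add_sub_cancel]

lemma pow_prime_sub_one_pow_modEq (ha : a.Coprime p) (k : ℕ) :
    PadicModEq p 2 (((a : ℚ_[p]) ^ (p - 1)) ^ k)
      (1 + k * p * ((fermatQuotient p a : ℚ) : ℚ_[p])) := by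
  obtain ⟨c, hc⟩ := exists_intCast_eq_fermatQuotient ha
  have power : (a : ℚ_[p]) ^ (p - 1) = 1 + p * c := by
    exact_mod_cast congrArg (Rat.cast (K := ℚ_[p])) (hc ▸ pow_prime_sub_one_eq (p := p) (a := a))
  obtain ⟨r, hr⟩ := Polynomial.powAddExpansion (1 : ℤ) (p * c) k
  have expansion := congrArg (Int.cast (R := ℚ_[p])) hr
  push_cast at expansion
  refine ⟨r * c ^ 2, ?_⟩
  rw [power, hc, expansion]
  push_cast
  ring

lemma four_pow_pow_modEq (hp : p = 2 * n + 1) (k : ℕ) :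
    PadicModEq p 2 (((4 : ℚ_[p]) ^ n) ^ k)
      (1 + k * p * ((fermatQuotient p 2 : ℚ) : ℚ_[p])) := by
  have coprime : Nat.Coprime 2 p := (Nat.coprime_two_left).2 ⟨n, hp⟩
  have := pow_prime_sub_one_pow_modEq coprime k
  rwa [show p - 1 = 2 * n by omega, pow_mul, show ((2 : ℕ) : ℚ_[p]) ^ 2 = 4 by norm_num] at this

end FermatQuotient

section HarmonicSums

variable {p : ℕ} [Fact p.Prime] {m n : ℕ}

lemma harmonicTerm_eq (m k : ℕ) :
    harmonicTerm m k = ((2 * k).choose k : ℚ) ^ (m + 2) / (4 ^ (m + 2)) ^ k *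
      (2 - (m + 2) * (4 * (k : ℚ) + 1) * harmonic k) * ((-1) ^ m) ^ k := by
  rw [harmonicTerm, div_pow, pow_right_comm]

lemma harmonicTerm_one (k : ℕ) :
    harmonicTerm 1 k = ((2 * k).choose k : ℚ) ^ 3 / 64 ^ k *
      (2 - 3 * (4 * (k : ℚ) + 1) * harmonic k) * (-1) ^ k := by
  rw [harmonicTerm_eq]
  norm_num

lemma harmonicTerm_two (k : ℕ) :
    harmonicTerm 2 k = ((2 * k).choose k : ℚ) ^ 4 / 256 ^ k *
      (2 - 4 * (4 * (k : ℚ) + 1) * harmonic k) := by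
  rw [harmonicTerm_eq]
  norm_num

lemma harmonicTerm_three (k : ℕ) :
    harmonicTerm 3 k = ((2 * k).choose k : ℚ) ^ 5 / 1024 ^ k *
      (2 - 5 * (4 * (k : ℚ) + 1) * harmonic k) * (-1) ^ k := by
  rw [harmonicTerm_eq]
  norm_num

lemma four_pow_pow_mem_subring (n k : ℕ) : ((4 : ℚ_[p]) ^ n) ^ k ∈ PadicInt.subring p :=
  pow_mem (pow_mem (mod_cast natCast_padic_mem_subring 4) n) k

lemma signed_four_pow_mem_subring (n : ℕ) :
    ((-1) ^ n * (4 ^ n) ^ 3 : ℚ_[p]) ∈ PadicInt.subring p :=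
  mul_mem (pow_mem (neg_mem (one_mem _)) n) (four_pow_pow_mem_subring n 3)

theorem sum_harmonicTerm_one_modEq (hp : p = 2 * n + 1) :
    PadicModEq p 2 (∑ k ∈ Finset.range p, harmonicTerm 1 k : ℚ)
      ((-1) ^ n * (2 + 6 * p * fermatQuotient p 2) : ℚ) := by
  have integral : (2 * (-1) ^ n : ℚ_[p]) ∈ PadicInt.subring p :=
    mul_mem (mod_cast natCast_padic_mem_subring 2) (pow_mem (neg_mem (one_mem _)) n)
  have quotient := (halfQuot_modEq hp).const_mul (mod_cast natCast_padic_mem_subring 2)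
  have power := (four_pow_pow_modEq hp 3).const_mul integral
  refine (harmonicSum_one_modEq hp).trans (quotient.trans ?_)
  rw [← mul_assoc]
  refine power.trans (.of_eq ?_)
  push_cast
  ring

theorem sum_harmonicTerm_two_modEq (hp : p = 2 * n + 1) :
    PadicModEq p 2 (∑ k ∈ Finset.range p, harmonicTerm 2 k : ℚ)
      (2 + 12 * p * fermatQuotient p 2 : ℚ) := by
  have two : (2 : ℚ_[p]) ∈ PadicInt.subring p := mod_cast natCast_padic_mem_subring 2
  have square := ((halfQuot_modEq hp).pow (signed_four_pow_mem_subring n) 2).const_mul two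
  have power := (four_pow_pow_modEq hp 6).const_mul two
  refine (harmonicSum_two_modEq hp).trans (square.trans ?_)
  rw [mul_pow, ← pow_mul, mul_comm n 2, pow_mul, neg_one_sq, one_pow, one_mul, ← pow_mul _ 3 2]
  refine power.trans (.of_eq ?_)
  push_cast
  ring

theorem sum_harmonicTerm_three_modEq (hp : p = 2 * (2 * m) + 1) (hp3 : 3 < p) :
    PadicModEq p 2 (∑ k ∈ Finset.range p, harmonicTerm 3 k : ℚ)
      (-((2 + 10 * p * fermatQuotient p 2 : ℚ) : ℚ_[p]) *
        (padicGamma p (PadicInt.inv 4) : ℚ_[p]) ^ 4) := by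
  have two : (2 : ℚ_[p]) ∈ PadicInt.subring p := mod_cast natCast_padic_mem_subring 2
  have gamma := padicGamma_inv_four_pow_modEq hp hp3
  have gamma_mem : (padicGamma p (PadicInt.inv 4) : ℚ_[p]) ^ 4 ∈ PadicInt.subring p :=
    pow_mem (padicGamma p (PadicInt.inv 4)).2 4
  have dixon : PadicModEq p 2 (dixonQuot p (2 * m))
      ((4 ^ (2 * m)) ^ 2 * -(padicGamma p (PadicInt.inv 4) : ℚ_[p]) ^ 4) := by
    have := gamma.symm.const_mul (neg_mem (one_mem _))
    rw [neg_one_mul, neg_neg, neg_one_mul] at this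
    exact (dixonQuot_modEq hp hp3).trans (this.const_mul (four_pow_pow_mem_subring (2 * m) 2))
  have product := (halfQuot_modEq hp).mul ((halfThreeFTwo_modEq hp hp3).trans dixon)
    (signed_four_pow_mem_subring (2 * m))
    (mul_mem (four_pow_pow_mem_subring (2 * m) 2) (neg_mem gamma_mem))
  have power := (four_pow_pow_modEq hp 5).const_mul (mul_mem two (neg_mem gamma_mem))
  refine (harmonicSum_three_modEq hp).trans ((product.const_mul two).trans ?_)
  convert power.trans (.of_eq ?_) using 1
  · rw [pow_mul (-1), neg_one_sq, one_pow]
    ring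
  · push_cast
    ring

theorem sum_harmonicTerm_three_modEq_zero (hp : p = 4 * m + 3) (hp3 : 3 < p) :
    PadicModEq p 2 (∑ k ∈ Finset.range p, harmonicTerm 3 k : ℚ) 0 := by
  have half : p = 2 * (2 * m + 1) + 1 := by omega
  have two : (2 : ℚ_[p]) ∈ PadicInt.subring p := mod_cast natCast_padic_mem_subring 2
  have product := ((halfQuot_modEq half).mul ((halfThreeFTwo_modEq half hp3).trans
    (dixonQuot_modEq_zero hp hp3)) (signed_four_pow_mem_subring _) (zero_mem _)).const_mul two
  rw [mul_zero, mul_zero] at product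
  exact (harmonicSum_three_modEq half).trans product

end HarmonicSums

theorem mainTheorem5 (p : ℕ) [Fact p.Prime] (hp : 3 < p) :
    PadicModEq p 2
      ((∑ k ∈ Finset.range p, ((2 * k).choose k : ℚ) ^ 3 / 64 ^ k *
          (2 - 3 * (4 * (k : ℚ) + 1) * harmonic k) * (-1) ^ k : ℚ) : ℚ_[p])
      (((-1) ^ ((p - 1) / 2) * (2 + 6 * (p : ℚ) * fermatQuotient p 2) : ℚ) : ℚ_[p]) ∧
    PadicModEq p 2
      ((∑ k ∈ Finset.range p, ((2 * k).choose k : ℚ) ^ 4 / 256 ^ k *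
          (2 - 4 * (4 * (k : ℚ) + 1) * harmonic k) : ℚ) : ℚ_[p])
      ((2 + 12 * (p : ℚ) * fermatQuotient p 2 : ℚ) : ℚ_[p]) ∧
    (p % 4 = 1 →
      PadicModEq p 2
        ((∑ k ∈ Finset.range p, ((2 * k).choose k : ℚ) ^ 5 / 1024 ^ k *
            (2 - 5 * (4 * (k : ℚ) + 1) * harmonic k) * (-1) ^ k : ℚ) : ℚ_[p])
        (-((2 + 10 * (p : ℚ) * fermatQuotient p 2 : ℚ) : ℚ_[p]) *
          ((padicGamma p (PadicInt.inv 4) : ℤ_[p]) : ℚ_[p]) ^ 4)) ∧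
    (p % 4 = 3 →
      PadicModEq p 2
        ((∑ k ∈ Finset.range p, ((2 * k).choose k : ℚ) ^ 5 / 1024 ^ k *
            (2 - 5 * (4 * (k : ℚ) + 1) * harmonic k) * (-1) ^ k : ℚ) : ℚ_[p])
        0) := by
  obtain ⟨n, hn⟩ := (Fact.out : p.Prime).odd_of_ne_two (by omega)
  simp only [← harmonicTerm_one, ← harmonicTerm_two, ← harmonicTerm_three]
  refine ⟨?_, sum_harmonicTerm_two_modEq hn, fun h1 => ?_, fun h3 => ?_⟩
  · rw [show (p - 1) / 2 = n by omega]
    exact sum_harmonicTerm_one_modEq hn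
  · exact sum_harmonicTerm_three_modEq (m := p / 4) (by omega) hp
  · exact sum_harmonicTerm_three_modEq_zero (m := p / 4) (by omega) hp
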